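/- **Proposition (Unity vector field).** Let $\ell,r,n\in\mathbb{Z}_{\ge 1}$. Consider the Hurwitz space $\mathscr{H}_{0,\ell+r+n+1}(\ell,r-1,\mathbf 0)$ of triples $(f,P_\infty,P_0)$, where $f$ is a rational function on $\mathbb{P}^1$ having a pole of order $\ell+1$ at $P_\infty$, a pole of order $r$ at $P_0\neq P_\infty$ and exactly $n$ further poles, all simple, modulo Möbius transformations; it is equipped with the third-kind Abelian differential $\omega$ with simple poles at $P_0$ and $P_\infty$ and residues $-1$ and $+1$ respectively. Every equivalence class has a representative with $P_\infty=\infty$, $P_0=0$ (so that $\omega=-\mathrm{d}w/w$) and $$\lambda(w)=\frac{w^{\ell+r+n+1}+a_{\ell+r+n}w^{\ell+r+n}+\dots+a_1w+a_0}{w^r\bigl(w^{n}+b_{n-1}w^{n-1}+\dots+b_0\bigr)},$$ where numerator and denominator are coprime and the $n$ roots of $w^{n}+b_{n-1}w^{n-1}+\dots+b_0$ are nonzero and pairwise distinct; conversely every such $\lambda$ with the poles $\infty,0$ defines a point of the Hurwitz space. Use $(a_0,\dots,a_{\ell+r+n},b_0,\dots,b_{n-1})$ as coordinates. For tangent vectors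 $X,Y,Z$ put $$\eta(X,Y)=\sum_{x\in\Gamma_\lambda}\operatorname{Res}_{x}\frac{X(\lambda)\,Y(\lambda)}{\mathrm{d}\lambda}\,\omega^2,\qquad c(X,Y,Z)=\sum_{x\in\Gamma_\lambda}\operatorname{Res}_{x}\frac{X(\lambda)\,Y(\lambda)\,Z(\lambda)}{\mathrm{d}\lambda}\,\omega^2,$$ where $\Gamma_\lambda$ is the set of critical points of $\lambda$ away from its poles and $X(\lambda)=\mathcal{L}_X\lambda$ is the derivative of $\lambda$ along $X$ at fixed $w$. Then at every point there is exactly one bilinear product $\circ$ on the tangent space with $\eta(X\circ Y,Z)=c(X,Y,Z)$ for all $X,Y,Z$, and the unity vector field, that is, the unique $e$ with $e\circ Y=Y\circ e=Y$ for all $Y$, is $$e=\frac{\partial}{\partial a_{r+n}}+b_{n-1}\frac{\partial}{\partial a_{r+n-1}}+\dots+b_0\frac{\partial}{\partial a_r}.$$ Moreover, at every point, $e$ is the only tangent vector with $\mathcal{L}_e\lambda=1$. -/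

import Mathlib

open Polynomial Topology Filter

noncomputable section

namespace HurwitzFrobenius

/-! ### Rational functions on the Riemann sphere and the Hurwitz space

A class in `𝓗_{0, ℓ+r+n+1}(ℓ, r-1, 0, …, 0)` equipped with the third kind differential `ω` is
represented by a rational function together with the two poles of `ω`; two such data define the
same point if they differ by a Möbius transformation of the sphere `OnePoint ℂ`. -/

/-- The order of the pole of `f` at a point of the Riemann sphere (`0` if there is no pole). -/
def poleOrder (f : RatFunc ℂ) : OnePoint ℂ → ℕ
  | none => f.intDegree.toNat
  | some x => f.denom.rootMultiplicity x

/-- A rational function `f` and two points `Pinf ≠ Pzero` of the Riemann sphere (the poles of `ω`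
with residue `+1` and `-1` respectively) such that `f` has a pole of order `ℓ + 1` at `Pinf`,
a pole of order `r` at `Pzero`, exactly `n` other poles, and those are simple. -/
structure IsHurwitzDatum (ℓ r n : ℕ) (f : RatFunc ℂ) (Pinf Pzero : OnePoint ℂ) : Prop where
  ne : Pinf ≠ Pzero
  order_inf : poleOrder f Pinf = ℓ + 1
  order_zero : poleOrder f Pzero = r
  simple : ∃ S : Finset (OnePoint ℂ), S.card = n ∧ Pinf ∉ S ∧ Pzero ∉ S ∧
    (∀ x ∈ S, poleOrder f x = 1) ∧
    ∀ x, x ∉ S → x ≠ Pinf → x ≠ Pzero → poleOrder f x = 0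

/-- The Möbius transformation of a matrix, `w ↦ (g₀₀ w + g₀₁) / (g₁₀ w + g₁₁)`, as a rational
function. -/
def moebius (g : GL (Fin 2) ℂ) : RatFunc ℂ :=
  (RatFunc.C (g 0 0) * RatFunc.X + RatFunc.C (g 0 1)) /
    (RatFunc.C (g 1 0) * RatFunc.X + RatFunc.C (g 1 1))

/-- Two data `(f, Pinf, Pzero)` and `(f', Pinf', Pzero')` are equivalent if `f' = f ∘ g` for a
Möbius transformation `g` that maps `Pinf'` to `Pinf` and `Pzero'` to `Pzero`. -/
def HurwitzEquiv (f : RatFunc ℂ) (Pinf Pzero : OnePoint ℂ)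
    (f' : RatFunc ℂ) (Pinf' Pzero' : OnePoint ℂ) : Prop :=
  ∃ g : GL (Fin 2) ℂ, f' = RatFunc.eval RatFunc.C (moebius g) f ∧
    g • Pinf' = Pinf ∧ g • Pzero' = Pzero

/-! ### The coordinates `(a, b)` -/

/-- The coordinate space, with points `(a, b) = (a_0, …, a_{ℓ+r+n}, b_0, …, b_{n-1})`. It is also
the tangent space at each of its points: a pair `X` stands for the tangent vector
`∑ k, X.1 k • ∂/∂a_k + ∑ j, X.2 j • ∂/∂b_j`. -/
abbrev Coord (ℓ r n : ℕ) : Type := (Fin (ℓ + r + n + 1) → ℂ) × (Fin n → ℂ)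

variable {ℓ r n : ℕ}

/-- The numerator `w^{ℓ+r+n+1} + a_{ℓ+r+n} w^{ℓ+r+n} + ⋯ + a_0`. -/
def numerator (p : Coord ℓ r n) : ℂ[X] :=
  X ^ (ℓ + r + n + 1) + ∑ k : Fin (ℓ + r + n + 1), C (p.1 k) * X ^ (k : ℕ)

/-- The factor `w^n + b_{n-1} w^{n-1} + ⋯ + b_0` of the denominator. -/
def poleFactor (p : Coord ℓ r n) : ℂ[X] :=
  X ^ n + ∑ j : Fin n, C (p.2 j) * X ^ (j : ℕ)

/-- The denominator `w^r (w^n + b_{n-1} w^{n-1} + ⋯ + b_0)`. -/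
def denominator (p : Coord ℓ r n) : ℂ[X] := X ^ r * poleFactor p

/-- `λ` as a rational function. -/
def superpotentialRat (p : Coord ℓ r n) : RatFunc ℂ :=
  algebraMap ℂ[X] (RatFunc ℂ) (numerator p) / algebraMap ℂ[X] (RatFunc ℂ) (denominator p)

/-- `λ` as a function of the complex variable `w`. -/
def superpotential (p : Coord ℓ r n) (w : ℂ) : ℂ :=
  (numerator p).eval w / (denominator p).eval w

/-- The values of the coordinates that occur: numerator and denominator are coprime, and the
`n` roots of `w^n + b_{n-1} w^{n-1} + ⋯ + b_0` are pairwise distinct and nonzero. -/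
def hurwitzDomain (ℓ r n : ℕ) : Set (Coord ℓ r n) :=
  {p | IsCoprime (numerator p) (denominator p) ∧ (poleFactor p).Separable ∧
    (poleFactor p).eval 0 ≠ 0}

/-- The coordinate vector `∂/∂a_k`. -/
def partialA (k : Fin (ℓ + r + n + 1)) : Coord ℓ r n := (Pi.single k 1, 0)

/-! ### The Frobenius structure -/

/-- The residue of `f` at `x`: the limit (for an isolated singularity, the eventual value) of
`(2πi)⁻¹ ∮ f` over positively oriented circles around `x` that shrink to `x`. -/
def residue (f : ℂ → ℂ) (x : ℂ) : ℂ :=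
  limUnder (𝓝[>] (0 : ℝ)) fun ρ => (2 * Real.pi * Complex.I)⁻¹ * ∮ z in C(x, ρ), f z

/-- The differential of the third kind with simple poles at `0` and `∞` and residues `-1` and
`+1` there is `ω = -dw/w`; this is its coefficient. -/
def omegaCoeff (w : ℂ) : ℂ := -w⁻¹

/-- The Lie derivative `X(λ)`, at a fixed value of `w`, of `λ` along a tangent vector `X`. -/
def lieSuperpotential (p X : Coord ℓ r n) (w : ℂ) : ℂ :=
  fderiv ℂ (fun q : Coord ℓ r n => superpotential q w) p X

/-- The set `Γ_λ` of (finite) critical points of `λ`, away from its poles. -/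
def criticalSet (p : Coord ℓ r n) : Set ℂ :=
  {x | (denominator p).eval x ≠ 0 ∧ deriv (superpotential p) x = 0}

/-- The Frobenius pairing `η(X, Y) = ∑_{x ∈ Γ_λ} Res_x X(λ) Y(λ) ω² / dλ`. -/
def pairing (p X Y : Coord ℓ r n) : ℂ :=
  ∑ᶠ x ∈ criticalSet p, residue (fun w =>
    lieSuperpotential p X w * lieSuperpotential p Y w * omegaCoeff w ^ 2 /
      deriv (superpotential p) w) x

/-- The three-point function `c(X, Y, Z) = ∑_{x ∈ Γ_λ} Res_x X(λ) Y(λ) Z(λ) ω² / dλ`. -/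
def threePoint (p X Y Z : Coord ℓ r n) : ℂ :=
  ∑ᶠ x ∈ criticalSet p, residue (fun w =>
    lieSuperpotential p X w * lieSuperpotential p Y w * lieSuperpotential p Z w *
      omegaCoeff w ^ 2 / deriv (superpotential p) w) x

/-- `mul` is the Frobenius product on the tangent space at `p`: the product `∘` with
`η(X ∘ Y, Z) = c(X, Y, Z)`. -/
def IsFrobeniusProduct (p : Coord ℓ r n)
    (mul : Coord ℓ r n →ₗ[ℂ] Coord ℓ r n →ₗ[ℂ] Coord ℓ r n) : Prop :=
  ∀ X Y Z : Coord ℓ r n, pairing p (mul X Y) Z = threePoint p X Y Z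

/-- The vector field `∂/∂a_{r+n} + b_{n-1} ∂/∂a_{r+n-1} + ⋯ + b_0 ∂/∂a_r`. -/
def unityField (p : Coord ℓ r n) : Coord ℓ r n :=
  partialA ⟨r + n, by omega⟩ + ∑ j : Fin n, p.2 j • partialA ⟨r + j, by omega⟩

end HurwitzFrobenius

end

namespace HurwitzFrobenius

variable {ℓ r n : ℕ}

/-! ### Residues of quotients of polynomials -/

/-! Write `λ = N / (w^r Q)`. Then `λ' = K / (w^{r+1} Q²)` and `X(λ) = G_X / U` with `U = w^r Q²`,
for polynomials `K` and `G_X`. The degree of `K` is the number of coordinates and `deg G_X < deg K`,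
while `N`, `Q` coprime makes `X ↦ G_X` injective. Hence `X ↦ G_X mod K` identifies the tangent space
with `ℂ[w]/(K)` (`tangentClass_bijective`).

The critical points are the roots of `K`, none of them a pole, so `w` and `U` are units modulo `K`.
Since `ω²/dλ` has coefficient `U / (w K)`, `η(X, Y)` is the residue sum of `G_X G_Y / (w U K)` and
`c` that of `G_X G_Y G_Z / (w U² K)`. The residue pairing modulo `K` is nondegenerate, also at
multiple roots (`dvd_of_sum_ratResidue_eq_zero`), so `η(X ∘ Y, ·) = c(X, Y, ·)` says exactly
`G_{X∘Y} = G_X G_Y U⁻¹` modulo `K` (`isFrobeniusProduct_iff`). The unity is the vector with `G_e =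
U`, that is, with `e(λ) = 1`.

For the normal form, affine maps and inversion carry the two marked poles to `∞` and `0`, and a
rescaling makes `N` monic (`exists_hurwitzEquiv_superpotentialRat`). -/

lemma eventually_sphere_of_eventually_punctured {x : ℂ} {p : ℂ → Prop} (h : ∀ᶠ w in 𝓝[≠] x, p w) :
    ∀ᶠ ρ in 𝓝[>] (0 : ℝ), ∀ w ∈ Metric.sphere x ρ, p w := by
  rw [eventually_nhdsWithin_iff, Metric.eventually_nhds_iff] at h
  obtain ⟨ε, hε, h⟩ := h
  filter_upwards [Ioo_mem_nhdsGT hε] with ρ hρ w hw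
  rw [Metric.mem_sphere] at hw
  refine h (by rw [hw]; exact hρ.2) ?_
  rintro rfl
  simp only [dist_self] at hw
  exact hρ.1.ne hw

lemma residue_congr {f g : ℂ → ℂ} {x : ℂ} (h : f =ᶠ[𝓝[≠] x] g) : residue f x = residue g x := by
  unfold residue limUnder
  congr 1
  refine Filter.map_congr ?_
  filter_upwards [eventually_sphere_of_eventually_punctured h, self_mem_nhdsWithin] with ρ hρ h0
  congr 1
  exact circleIntegral.integral_congr (le_of_lt h0) hρ

lemma residue_eq_of_eventually {f : ℂ → ℂ} {x c : ℂ}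
    (h : ∀ᶠ ρ in 𝓝[>] (0 : ℝ), (2 * Real.pi * Complex.I)⁻¹ * (∮ z in C(x, ρ), f z) = c) :
    residue f x = c :=
  (tendsto_const_nhds.congr' (h.mono fun _ hρ => hρ.symm)).limUnder_eq

lemma eventually_eval_ne_zero {R : ℂ[X]} (hR : R ≠ 0) (x : ℂ) : ∀ᶠ w in 𝓝[≠] x, R.eval w ≠ 0 := by
  have h : ∀ᶠ w in 𝓝[≠] x, w ∉ ((R.roots.toFinset.erase x : Finset ℂ) : Set ℂ) :=
    nhdsWithin_le_nhds ((Finset.finite_toSet _).isClosed.isOpen_compl.mem_nhds (by simp))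
  filter_upwards [h, self_mem_nhdsWithin] with w hw hne h0
  exact hw (by simpa [hR, h0] using hne)

/-- The residue of `P / R` at `x`. -/
noncomputable def ratResidue (P R : ℂ[X]) (x : ℂ) : ℂ :=
  residue (fun w => P.eval w / R.eval w) x

/-- By Cauchy on an annulus the integral does not depend on a small radius, so the limit defining
the residue is an attained value. This makes residues additive. -/
lemma ratResidue_spec (P : ℂ[X]) {R : ℂ[X]} (hR : R ≠ 0) (x : ℂ) :
    ∀ᶠ ρ in 𝓝[>] (0 : ℝ), CircleIntegrable (fun w => P.eval w / R.eval w) x ρ ∧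
      (2 * Real.pi * Complex.I)⁻¹ * (∮ z in C(x, ρ), P.eval z / R.eval z) = ratResidue P R x := by
  have h := eventually_eval_ne_zero hR x
  have hsph := eventually_sphere_of_eventually_punctured h
  rw [eventually_nhdsWithin_iff, Metric.eventually_nhds_iff] at h
  obtain ⟨ε, hε, h⟩ := h
  have hne : ∀ z, z ∈ Metric.ball x ε → z ≠ x → R.eval z ≠ 0 := fun z hz hzx => h hz hzx
  have hconst : ∀ ρ ∈ Set.Ioo (0 : ℝ) (ε / 2), (∮ z in C(x, ρ), P.eval z / R.eval z) =
      ∮ z in C(x, ε / 2), P.eval z / R.eval z := by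
    intro ρ hρ
    have hd : ∀ z ∈ Metric.closedBall x (ε / 2) \ Metric.ball x ρ,
        DifferentiableAt ℂ (fun w => P.eval w / R.eval w) z := by
      intro z hz
      refine P.differentiable.differentiableAt.div R.differentiable.differentiableAt (hne z ?_ ?_)
      · exact Metric.closedBall_subset_ball (by linarith) hz.1
      · rintro rfl
        exact hz.2 (Metric.mem_ball_self hρ.1)
    refine (Complex.circleIntegral_eq_of_differentiable_on_annulus_off_countable hρ.1 hρ.2.le
      Set.countable_empty (fun z hz => (hd z hz).continuousAt.continuousWithinAt)
      fun z hz => hd z ⟨Metric.ball_subset_closedBall hz.1.1, fun hb => hz.1.2 ?_⟩).symm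
    exact Metric.ball_subset_closedBall hb
  have hε2 : (0 : ℝ) < ε / 2 := by linarith
  have hval : ratResidue P R x =
      (2 * Real.pi * Complex.I)⁻¹ * ∮ z in C(x, ε / 2), P.eval z / R.eval z := by
    refine residue_eq_of_eventually ?_
    filter_upwards [Ioo_mem_nhdsGT hε2] with ρ hρ
    rw [hconst ρ hρ]
  filter_upwards [Ioo_mem_nhdsGT hε2, hsph] with ρ hρ hs
  refine ⟨ContinuousOn.circleIntegrable hρ.1.le ?_, by rw [hconst ρ hρ, hval]⟩
  exact P.continuous.continuousOn.div R.continuous.continuousOn hs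

lemma ratResidue_add (P₁ P₂ : ℂ[X]) {R : ℂ[X]} (hR : R ≠ 0) (x : ℂ) :
    ratResidue (P₁ + P₂) R x = ratResidue P₁ R x + ratResidue P₂ R x := by
  refine residue_eq_of_eventually ?_
  filter_upwards [ratResidue_spec P₁ hR x, ratResidue_spec P₂ hR x] with ρ h₁ h₂
  rw [← h₁.2, ← h₂.2, ← mul_add, ← circleIntegral.integral_add h₁.1 h₂.1]
  simp only [eval_add, add_div]

lemma ratResidue_mul_right (P R : ℂ[X]) {T : ℂ[X]} (hT : T ≠ 0) (x : ℂ) :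
    ratResidue (P * T) (R * T) x = ratResidue P R x := by
  refine residue_congr ?_
  filter_upwards [eventually_eval_ne_zero hT x] with w hw
  rw [eval_mul, eval_mul, mul_div_mul_right _ _ hw]

lemma ratResidue_X_sub_C (P : ℂ[X]) (x : ℂ) : ratResidue P (X - C x) x = P.eval x := by
  refine residue_eq_of_eventually ?_
  filter_upwards [self_mem_nhdsWithin] with ρ (hρ : 0 < ρ)
  have h := (P.differentiable.diffContOnCl (s := Metric.ball x ρ)).circleIntegral_sub_inv_smul
    (Metric.mem_ball_self hρ)
  have h2 : (∮ z in C(x, ρ), P.eval z / (X - C x).eval z) =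
      ∮ z in C(x, ρ), (z - x)⁻¹ • P.eval z := by
    simp only [eval_sub, eval_X, eval_C, smul_eq_mul, div_eq_inv_mul]
  rw [h2, h, smul_eq_mul, inv_mul_cancel_left₀ Complex.two_pi_I_ne_zero]

lemma ratResidue_eq_zero (P : ℂ[X]) {R : ℂ[X]} {x : ℂ} (hx : R.eval x ≠ 0) :
    ratResidue P R x = 0 := by
  refine residue_eq_of_eventually ?_
  have h : ∀ᶠ w in 𝓝 x, R.eval w ≠ 0 := R.continuous.continuousAt.eventually_ne hx
  obtain ⟨ε, hε, h⟩ := Metric.eventually_nhds_iff.1 h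
  filter_upwards [Ioo_mem_nhdsGT hε] with ρ hρ
  have hd : ∀ z ∈ Metric.closedBall x ρ,
      DifferentiableAt ℂ (fun w => P.eval w / R.eval w) z := fun z hz =>
    P.differentiable.differentiableAt.div R.differentiable.differentiableAt
      (h (lt_of_le_of_lt hz hρ.2))
  rw [Complex.circleIntegral_eq_zero_of_differentiable_on_off_countable hρ.1.le
    Set.countable_empty (fun z hz => (hd z hz).continuousAt.continuousWithinAt)
    fun z hz => hd z (Metric.ball_subset_closedBall hz.1), mul_zero]

/-- Over a common denominator the difference of the fractions loses its factor `K` and is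
holomorphic at `x`. So the residue depends only on `P / V` modulo `K`. -/
lemma ratResidue_congr_of_dvd {K P₁ V₁ P₂ V₂ : ℂ[X]} {x : ℂ} (hK : K ≠ 0)
    (h₁ : V₁.eval x ≠ 0) (h₂ : V₂.eval x ≠ 0) (h : K ∣ P₁ * V₂ - P₂ * V₁) :
    ratResidue P₁ (V₁ * K) x = ratResidue P₂ (V₂ * K) x := by
  obtain ⟨T, hT⟩ := h
  have n₁ : V₁ ≠ 0 := by rintro rfl; simp at h₁
  have n₂ : V₂ ≠ 0 := by rintro rfl; simp at h₂
  rw [← ratResidue_mul_right P₁ (V₁ * K) n₂, ← ratResidue_mul_right P₂ (V₂ * K) n₁,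
    show P₁ * V₂ = P₂ * V₁ + T * K by linear_combination hT,
    show V₁ * K * V₂ = V₂ * K * V₁ by ring,
    ratResidue_add _ _ (mul_ne_zero (mul_ne_zero n₂ hK) n₁),
    show V₂ * K * V₁ = V₂ * V₁ * K by ring, ratResidue_mul_right T _ hK,
    ratResidue_eq_zero T (by rw [eval_mul]; exact mul_ne_zero h₂ h₁), add_zero]

/-- The residue pairing on `ℂ[X] / (K)` is nondegenerate. -/
lemma dvd_of_sum_ratResidue_eq_zero {K V P : ℂ[X]} (hK : K ≠ 0)
    (hV : ∀ x ∈ K.roots.toFinset, V.eval x ≠ 0)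
    (h : ∀ H : ℂ[X], ∑ x ∈ K.roots.toFinset, ratResidue (P * H) (V * K) x = 0) : K ∣ P := by
  by_contra hdvd
  have hP : P ≠ 0 := by rintro rfl; exact hdvd (dvd_zero K)
  obtain ⟨x, hx⟩ : ∃ x, P.rootMultiplicity x < K.rootMultiplicity x := by
    by_contra! hle
    refine hdvd ((IsAlgClosed.splits K).dvd_of_roots_le_roots hK ?_)
    exact Multiset.le_iff_count.2 fun a => by simpa using hle a
  obtain ⟨P₀, hP₀, hP₀x⟩ := exists_eq_pow_rootMultiplicity_mul_and_not_dvd P hP x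
  obtain ⟨K₀, hK₀, hK₀x⟩ := exists_eq_pow_rootMultiplicity_mul_and_not_dvd K hK x
  set k := P.rootMultiplicity x
  obtain ⟨j, hj⟩ : ∃ j, K.rootMultiplicity x = k + j + 1 := ⟨K.rootMultiplicity x - k - 1, by omega⟩
  have hxK : x ∈ K.roots.toFinset := by
    rw [Multiset.mem_toFinset, ← Multiset.one_le_count_iff_mem, count_roots]
    omega
  have hV0 : V ≠ 0 := by rintro rfl; simpa using hV x hxK
  have hK₀0 : K₀ ≠ 0 := by rintro rfl; simp at hK₀x
  -- The test polynomial cancels all of `K` but one factor at `x`: the quotient becomes `P₀ / (X -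
  -- x)`, whose only residue is `P₀(x) ≠ 0`.
  have key : ∀ y, ratResidue (P * ((X - C x) ^ j * K₀ * V)) (V * K) y =
      ratResidue P₀ (X - C x) y := by
    intro y
    have hT : (X - C x) ^ (k + j) * K₀ * V ≠ 0 :=
      mul_ne_zero (mul_ne_zero (pow_ne_zero _ (X_sub_C_ne_zero x)) hK₀0) hV0
    rw [← ratResidue_mul_right P₀ _ hT]
    congr 1
    · rw [hP₀]; ring
    · rw [hK₀, hj]; ring
  have h0 := h ((X - C x) ^ j * K₀ * V)
  simp only [key] at h0
  rw [Finset.sum_eq_single_of_mem x hxK, ratResidue_X_sub_C] at h0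
  · exact hP₀x (dvd_iff_isRoot.2 h0)
  · intro y _ hy
    exact ratResidue_eq_zero _ (by simpa [sub_eq_zero] using hy)

/-! ### Tangent vectors as polynomials -/

/-- The polynomial of degree less than `m` with the given coefficients. -/
noncomputable def ofCoeffs (m : ℕ) : (Fin m → ℂ) →ₗ[ℂ] ℂ[X] where
  toFun c := ∑ k : Fin m, C (c k) * X ^ (k : ℕ)
  map_add' c d := by simp [add_mul, Finset.sum_add_distrib]
  map_smul' t c := by simp [Finset.smul_sum, smul_eq_C_mul, mul_assoc]

lemma ofCoeffs_apply {m : ℕ} (c : Fin m → ℂ) :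
    ofCoeffs m c = ∑ k : Fin m, C (c k) * X ^ (k : ℕ) := rfl

lemma coeff_ofCoeffs {m : ℕ} (c : Fin m → ℂ) (k : Fin m) : (ofCoeffs m c).coeff k = c k := by
  rw [ofCoeffs_apply, finsetSum_coeff, Finset.sum_eq_single k]
  · simp
  · intro j _ hj
    rw [coeff_C_mul_X_pow, if_neg fun h => hj (Fin.ext h.symm)]
  · simp

lemma ofCoeffs_injective (m : ℕ) : Function.Injective (ofCoeffs m) := fun c d h => by
  ext k
  rw [← coeff_ofCoeffs c, h, coeff_ofCoeffs]

lemma degree_ofCoeffs_lt {m : ℕ} (c : Fin m → ℂ) : (ofCoeffs m c).degree < m := by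
  rw [ofCoeffs_apply, ← mem_degreeLT]
  refine Submodule.sum_mem _ fun k _ => mem_degreeLT.2 ?_
  exact (degree_C_mul_X_pow_le _ _).trans_lt (by exact_mod_cast k.2)

lemma numerator_eq (p : Coord ℓ r n) :
    numerator p = X ^ (ℓ + r + n + 1) + ofCoeffs _ p.1 := rfl

lemma poleFactor_eq (p : Coord ℓ r n) : poleFactor p = X ^ n + ofCoeffs _ p.2 := rfl

lemma monic_numerator (p : Coord ℓ r n) : (numerator p).Monic :=
  monic_X_pow_add (degree_ofCoeffs_lt p.1)

lemma natDegree_numerator (p : Coord ℓ r n) : (numerator p).natDegree = ℓ + r + n + 1 := by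
  rw [numerator_eq, natDegree_add_eq_left_of_degree_lt, natDegree_X_pow]
  rw [degree_X_pow]; exact degree_ofCoeffs_lt p.1

lemma monic_poleFactor (p : Coord ℓ r n) : (poleFactor p).Monic :=
  monic_X_pow_add (degree_ofCoeffs_lt p.2)

lemma natDegree_poleFactor (p : Coord ℓ r n) : (poleFactor p).natDegree = n := by
  rw [poleFactor_eq, natDegree_add_eq_left_of_degree_lt, natDegree_X_pow]
  rw [degree_X_pow]; exact degree_ofCoeffs_lt p.2

lemma monic_denominator (p : Coord ℓ r n) : (denominator p).Monic :=
  (monic_X_pow r).mul (monic_poleFactor p)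

lemma natDegree_denominator (p : Coord ℓ r n) : (denominator p).natDegree = r + n := by
  rw [denominator, (monic_X_pow r).natDegree_mul (monic_poleFactor p), natDegree_X_pow,
    natDegree_poleFactor]

/-- The polynomial `K` with `λ' = K / (w^{r+1} Q^2)`, where `Q` is the pole factor. -/
noncomputable def criticalPoly (p : Coord ℓ r n) : ℂ[X] :=
  derivative (numerator p) * (X * poleFactor p) -
    numerator p * (C (r : ℂ) * poleFactor p + X * derivative (poleFactor p))

/-- The polynomial `G` with `X(λ) = G / (w^r Q^2)`, where `Q` is the pole factor. -/
noncomputable def tangentPoly (p : Coord ℓ r n) : Coord ℓ r n →ₗ[ℂ] ℂ[X] where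
  toFun Y := ofCoeffs _ Y.1 * poleFactor p - numerator p * ofCoeffs _ Y.2
  map_add' Y Z := by simp only [Prod.fst_add, Prod.snd_add, map_add]; ring
  map_smul' t Y := by
    simp only [Prod.smul_fst, Prod.smul_snd, map_smul, RingHom.id_apply, smul_eq_C_mul]; ring

lemma tangentPoly_apply (p Y : Coord ℓ r n) :
    tangentPoly p Y = ofCoeffs _ Y.1 * poleFactor p - numerator p * ofCoeffs _ Y.2 := rfl

/-! ### The derivatives of `λ` as quotients of polynomials -/

lemma eval_denominator_ne_zero_iff (hr : 1 ≤ r) (p : Coord ℓ r n) (w : ℂ) :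
    (denominator p).eval w ≠ 0 ↔ w ≠ 0 ∧ (poleFactor p).eval w ≠ 0 := by
  rw [denominator, eval_mul, eval_pow, eval_X, mul_ne_zero_iff, pow_ne_zero_iff (by omega)]

lemma deriv_superpotential (hr : 1 ≤ r) (p : Coord ℓ r n) {w : ℂ}
    (hw : (denominator p).eval w ≠ 0) :
    deriv (superpotential p) w =
      (criticalPoly p).eval w / (w ^ (r + 1) * (poleFactor p).eval w ^ 2) := by
  obtain ⟨h0, hQ⟩ := (eval_denominator_ne_zero_iff hr p w).1 hw
  have h := ((numerator p).hasDerivAt w).div ((denominator p).hasDerivAt w) hw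
  have h' : deriv (superpotential p) w = _ := h.deriv
  rw [h']
  -- The quotient rule gives the denominator `w^{2r} Q²`; the numerator contains `w^{r-1}`, which
  -- cancels to leave `w^{r+1}`.
  obtain ⟨s, rfl⟩ : ∃ s, r = s + 1 := ⟨r - 1, by omega⟩
  rw [criticalPoly, denominator]
  simp only [derivative_mul, derivative_X_pow, eval_mul, eval_add, eval_sub, eval_pow, eval_X,
    eval_C, add_tsub_cancel_right]
  field_simp
  ring

lemma hasFDerivAt_superpotential (p : Coord ℓ r n) {w : ℂ} (hw : (denominator p).eval w ≠ 0) :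
    ∃ L : Coord ℓ r n →L[ℂ] ℂ, HasFDerivAt (fun q : Coord ℓ r n => superpotential q w) L p ∧
      ∀ Y, L Y = ((ofCoeffs _ Y.1).eval w * (denominator p).eval w -
        (numerator p).eval w * (w ^ r * (ofCoeffs _ Y.2).eval w)) / (denominator p).eval w ^ 2 := by
  let A : Coord ℓ r n →L[ℂ] ℂ := LinearMap.toContinuousLinearMap
    (leval w ∘ₗ ofCoeffs (ℓ + r + n + 1) ∘ₗ LinearMap.fst ℂ _ _)
  let B : Coord ℓ r n →L[ℂ] ℂ := LinearMap.toContinuousLinearMap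
    (leval w ∘ₗ ofCoeffs n ∘ₗ LinearMap.snd ℂ _ _)
  have hN : HasFDerivAt (fun q : Coord ℓ r n => (numerator q).eval w) A p := by
    have : (fun q : Coord ℓ r n => (numerator q).eval w) =
        fun q => w ^ (ℓ + r + n + 1) + A q := by
      ext q; simp [numerator_eq, A, leval]
    rw [this]
    exact A.hasFDerivAt.const_add _
  have hD : HasFDerivAt (fun q : Coord ℓ r n => (denominator q).eval w) (w ^ r • B) p := by
    have : (fun q : Coord ℓ r n => (denominator q).eval w) =
        fun q => w ^ r * (w ^ n + B q) := by
      ext q; simp [denominator, poleFactor_eq, B, leval]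
    rw [this]
    exact (B.hasFDerivAt.const_add _).const_mul _
  have h := hN.mul ((hasDerivAt_inv hw).comp_hasFDerivAt p hD)
  refine ⟨_, h.congr_of_eventuallyEq (.of_forall fun q => div_eq_mul_inv _ _), fun Y => ?_⟩
  simp [A, B, leval]
  field_simp
  ring

lemma lieSuperpotential_eq (hr : 1 ≤ r) (p Y : Coord ℓ r n) {w : ℂ}
    (hw : (denominator p).eval w ≠ 0) :
    lieSuperpotential p Y w =
      (tangentPoly p Y).eval w / (w ^ r * (poleFactor p).eval w ^ 2) := by
  obtain ⟨L, hL, hLY⟩ := hasFDerivAt_superpotential p hw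
  obtain ⟨h0, hQ⟩ := (eval_denominator_ne_zero_iff hr p w).1 hw
  rw [lieSuperpotential, hL.fderiv, hLY, tangentPoly_apply, denominator]
  simp only [eval_mul, eval_sub, eval_pow, eval_X]
  field_simp

/-- The top coefficient is `(ℓ+r+n+1) - (r+n) = ℓ+1`, the order of the pole at infinity, hence
nonzero. -/
lemma natDegree_criticalPoly (p : Coord ℓ r n) :
    (criticalPoly p).natDegree = ℓ + r + n + 1 + n := by
  have hN := natDegree_numerator p
  have hQ := natDegree_poleFactor p
  have hN1 : (numerator p).coeff (ℓ + r + n + 1) = 1 := by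
    rw [← hN]; exact monic_numerator p
  have hQ1 : (poleFactor p).coeff n = 1 := by
    have := monic_poleFactor p
    rwa [Monic, leadingCoeff, hQ] at this
  have dN : (derivative (numerator p)).natDegree ≤ ℓ + r + n := by
    have := natDegree_derivative_le (numerator p); omega
  have dXQ : (X * poleFactor p).natDegree ≤ n + 1 := by
    have := natDegree_mul_le (p := X) (q := poleFactor p)
    rw [natDegree_X] at this; omega
  have dQ' : (C (r : ℂ) * poleFactor p + X * derivative (poleFactor p)).natDegree ≤ n := by
    refine natDegree_add_le_of_degree_le ((natDegree_C_mul_le _ _).trans hQ.le) ?_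
    by_cases hd : derivative (poleFactor p) = 0
    · simp [hd]
    · have h1 : n ≠ 0 := by
        rintro rfl
        exact hd (by rw [eq_C_of_natDegree_eq_zero hQ, derivative_C])
      have h2 := natDegree_derivative_le (poleFactor p)
      have h3 := natDegree_mul_le (p := X) (q := derivative (poleFactor p))
      rw [natDegree_X] at h3
      omega
  have c1 : (derivative (numerator p) * (X * poleFactor p)).coeff (ℓ + r + n + 1 + n) =
      ((ℓ + r + n + 1 : ℕ) : ℂ) := by
    rw [show ℓ + r + n + 1 + n = (ℓ + r + n) + (n + 1) by ring,
      coeff_mul_add_eq_of_natDegree_le dN dXQ, coeff_derivative, hN1, coeff_X_mul, hQ1]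
    push_cast; ring
  have c2 : (numerator p * (C (r : ℂ) * poleFactor p + X * derivative (poleFactor p))).coeff
      (ℓ + r + n + 1 + n) = ((r + n : ℕ) : ℂ) := by
    rw [coeff_mul_add_eq_of_natDegree_le hN.le dQ', hN1, coeff_add, coeff_C_mul, hQ1]
    rcases n with _ | m
    · simp
    · rw [coeff_X_mul, coeff_derivative, hQ1]
      push_cast; ring
  refine natDegree_eq_of_le_of_coeff_ne_zero ?_ ?_
  · refine (natDegree_sub_le _ _).trans (max_le ?_ ?_)
    · exact natDegree_mul_le.trans (by omega)
    · exact natDegree_mul_le.trans (by omega)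
  · rw [criticalPoly, coeff_sub, c1, c2, ← Nat.cast_sub (by omega)]
    exact Nat.cast_ne_zero.2 (by omega)

lemma criticalPoly_ne_zero (p : Coord ℓ r n) : criticalPoly p ≠ 0 := by
  intro h
  have := natDegree_criticalPoly p
  rw [h, natDegree_zero] at this
  omega

/-- At `0` the value of `K` is `-r N(0) Q(0)`, and at a root `w` of `Q` it is `-w N(w) Q'(w)`.
Coprimality, separability and `Q(0) ≠ 0` keep both away from zero. -/
lemma eval_denominator_ne_zero_of_isRoot (hr : 1 ≤ r) {p : Coord ℓ r n}
    (hp : p ∈ hurwitzDomain ℓ r n) {w : ℂ} (hw : (criticalPoly p).eval w = 0) :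
    (denominator p).eval w ≠ 0 := by
  obtain ⟨hcop, hsep, hQ0⟩ := hp
  intro hD
  have hN : (numerator p).eval w ≠ 0 := by
    intro hN
    obtain ⟨a, b, hab⟩ := hcop
    have := congrArg (eval w) hab
    simp [hN, hD] at this
  rw [criticalPoly] at hw
  simp only [eval_mul, eval_sub, eval_add, eval_X, eval_C] at hw
  by_cases h0 : w = 0
  · subst h0
    simp only [zero_mul, mul_zero, add_zero, zero_sub, neg_eq_zero, mul_eq_zero, hN, hQ0,
      Nat.cast_eq_zero, false_or, or_false] at hw
    omega
  · have hQ : (poleFactor p).eval w = 0 := by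
      by_contra hQ
      exact (eval_denominator_ne_zero_iff hr p w).2 ⟨h0, hQ⟩ hD
    obtain ⟨a, b, hab⟩ := hsep
    have := congrArg (eval w) hab
    simp only [eval_add, eval_mul, hQ, mul_zero, zero_add, eval_one] at this
    simp only [hQ, mul_zero, zero_add, zero_sub, neg_eq_zero, mul_eq_zero, hN, h0, false_or] at hw
    simp [hw] at this

lemma criticalSet_eq (hr : 1 ≤ r) {p : Coord ℓ r n} (hp : p ∈ hurwitzDomain ℓ r n) :
    criticalSet p = ((criticalPoly p).roots.toFinset : Set ℂ) := by
  ext w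
  simp only [criticalSet, Set.mem_ofPred_eq, Finset.mem_coe, Multiset.mem_toFinset,
    mem_roots (criticalPoly_ne_zero p), IsRoot.def]
  have key : ∀ hD : (denominator p).eval w ≠ 0,
      deriv (superpotential p) w = 0 ↔ (criticalPoly p).eval w = 0 := by
    intro hD
    obtain ⟨h0, hQ⟩ := (eval_denominator_ne_zero_iff hr p w).1 hD
    rw [deriv_superpotential hr p hD, div_eq_zero_iff, or_iff_left]
    exact mul_ne_zero (pow_ne_zero _ h0) (pow_ne_zero _ hQ)
  exact ⟨fun h => (key h.1).1 h.2, fun h =>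
    ⟨eval_denominator_ne_zero_of_isRoot hr hp h,
      (key (eval_denominator_ne_zero_of_isRoot hr hp h)).2 h⟩⟩

/-- The polynomial `w^r Q^2`, the denominator of `X(λ)` for tangent vectors `X`. -/
noncomputable def tangentDenom (p : Coord ℓ r n) : ℂ[X] := X ^ r * poleFactor p ^ 2

lemma eval_tangentDenom (p : Coord ℓ r n) (w : ℂ) :
    (tangentDenom p).eval w = w ^ r * (poleFactor p).eval w ^ 2 := by
  simp [tangentDenom]

lemma eval_tangentDenom_ne_zero (hr : 1 ≤ r) (p : Coord ℓ r n) {w : ℂ}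
    (hw : (denominator p).eval w ≠ 0) : (tangentDenom p).eval w ≠ 0 := by
  obtain ⟨h0, hQ⟩ := (eval_denominator_ne_zero_iff hr p w).1 hw
  rw [eval_tangentDenom]
  exact mul_ne_zero (pow_ne_zero _ h0) (pow_ne_zero _ hQ)

/-! ### Pairing and three-point function as residue sums over the roots of `K` -/

lemma pairing_eq (hr : 1 ≤ r) {p : Coord ℓ r n} (hp : p ∈ hurwitzDomain ℓ r n)
    (Y Z : Coord ℓ r n) :
    pairing p Y Z = ∑ x ∈ (criticalPoly p).roots.toFinset,
      ratResidue (tangentPoly p Y * tangentPoly p Z) (X * tangentDenom p * criticalPoly p) x := by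
  rw [pairing, criticalSet_eq hr hp, finsum_mem_coe_finset]
  refine Finset.sum_congr rfl fun x _ => residue_congr ?_
  filter_upwards [eventually_eval_ne_zero (monic_denominator p).ne_zero x,
    eventually_eval_ne_zero (criticalPoly_ne_zero p) x] with w hw hK
  obtain ⟨h0, hQ⟩ := (eval_denominator_ne_zero_iff hr p w).1 hw
  rw [lieSuperpotential_eq hr p Y hw, lieSuperpotential_eq hr p Z hw,
    deriv_superpotential hr p hw, omegaCoeff]
  simp only [eval_mul, eval_tangentDenom, eval_X]
  field_simp
  ring

lemma threePoint_eq (hr : 1 ≤ r) {p : Coord ℓ r n} (hp : p ∈ hurwitzDomain ℓ r n)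
    (Y Z W : Coord ℓ r n) :
    threePoint p Y Z W = ∑ x ∈ (criticalPoly p).roots.toFinset,
      ratResidue (tangentPoly p Y * tangentPoly p Z * tangentPoly p W)
        (X * tangentDenom p ^ 2 * criticalPoly p) x := by
  rw [threePoint, criticalSet_eq hr hp, finsum_mem_coe_finset]
  refine Finset.sum_congr rfl fun x _ => residue_congr ?_
  filter_upwards [eventually_eval_ne_zero (monic_denominator p).ne_zero x,
    eventually_eval_ne_zero (criticalPoly_ne_zero p) x] with w hw hK
  obtain ⟨h0, hQ⟩ := (eval_denominator_ne_zero_iff hr p w).1 hw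
  rw [lieSuperpotential_eq hr p Y hw, lieSuperpotential_eq hr p Z hw,
    lieSuperpotential_eq hr p W hw, deriv_superpotential hr p hw, omegaCoeff]
  simp only [eval_mul, eval_pow, eval_tangentDenom, eval_X]
  field_simp
  ring

/-! ### The tangent space as `ℂ[w]/(K)` -/

lemma degree_tangentPoly_lt (p Y : Coord ℓ r n) :
    (tangentPoly p Y).degree < (criticalPoly p).degree := by
  rw [degree_eq_natDegree (criticalPoly_ne_zero p), natDegree_criticalPoly]
  have hQ : (poleFactor p).degree = n := by
    rw [degree_eq_natDegree (monic_poleFactor p).ne_zero, natDegree_poleFactor]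
  have hN : (numerator p).degree = (ℓ + r + n + 1 : ℕ) := by
    rw [degree_eq_natDegree (monic_numerator p).ne_zero, natDegree_numerator]
  rw [tangentPoly_apply, Nat.cast_add]
  refine (degree_sub_le _ _).trans_lt (max_lt ?_ ?_)
  · rw [degree_mul, hQ]
    exact WithBot.add_lt_add_right (by simp) (degree_ofCoeffs_lt Y.1)
  · rw [degree_mul, hN]
    exact WithBot.add_lt_add_left (by simp) (degree_ofCoeffs_lt Y.2)

/-- If `A Q = N B`, coprimality gives `Q ∣ B`; as `deg B < deg Q`, `B = 0` and then `A = 0`. -/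
lemma tangentPoly_injective {p : Coord ℓ r n} (hp : p ∈ hurwitzDomain ℓ r n) :
    Function.Injective (tangentPoly p) := by
  rw [← LinearMap.ker_eq_bot, LinearMap.ker_eq_bot']
  intro Y hY
  rw [tangentPoly_apply, sub_eq_zero] at hY
  have hcop : IsCoprime (poleFactor p) (numerator p) :=
    (IsCoprime.of_isCoprime_of_dvd_right hp.1 (Dvd.intro_left _ rfl)).symm
  have hdvd : poleFactor p ∣ ofCoeffs _ Y.2 := hcop.dvd_of_dvd_mul_left (Dvd.intro_left _ hY)
  have h2 : ofCoeffs _ Y.2 = 0 := by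
    refine eq_zero_of_dvd_of_degree_lt hdvd ?_
    rw [degree_eq_natDegree (monic_poleFactor p).ne_zero, natDegree_poleFactor]
    exact degree_ofCoeffs_lt Y.2
  rw [h2, mul_zero, mul_eq_zero, or_iff_left (monic_poleFactor p).ne_zero] at hY
  exact Prod.ext (ofCoeffs_injective _ (by rw [hY]; exact (map_zero _).symm))
    (ofCoeffs_injective _ (by rw [h2]; exact (map_zero _).symm))

/-- The map from the tangent space to `ℂ[w] / (K)`. -/
noncomputable def tangentClass (p : Coord ℓ r n) : Coord ℓ r n →ₗ[ℂ] AdjoinRoot (criticalPoly p) :=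
  (AdjoinRoot.mkₐ (criticalPoly p)).toLinearMap ∘ₗ tangentPoly p

lemma tangentClass_apply (p Y : Coord ℓ r n) :
    tangentClass p Y = AdjoinRoot.mk (criticalPoly p) (tangentPoly p Y) := rfl

lemma tangentClass_bijective {p : Coord ℓ r n} (hp : p ∈ hurwitzDomain ℓ r n) :
    Function.Bijective (tangentClass p) := by
  have hinj : Function.Injective (tangentClass p) := by
    rw [← LinearMap.ker_eq_bot, LinearMap.ker_eq_bot']
    intro Y hY
    rw [tangentClass_apply, AdjoinRoot.mk_eq_zero] at hY
    exact tangentPoly_injective hp ((eq_zero_of_dvd_of_degree_lt hY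
      (degree_tangentPoly_lt p Y)).trans (map_zero _).symm)
  have hK := criticalPoly_ne_zero p
  have : FiniteDimensional ℂ (AdjoinRoot (criticalPoly p)) := (AdjoinRoot.powerBasis hK).finite
  refine ⟨hinj, (LinearMap.injective_iff_surjective_of_finrank_eq_finrank ?_).1 hinj⟩
  rw [(AdjoinRoot.powerBasis hK).finrank, AdjoinRoot.powerBasis_dim, natDegree_criticalPoly]
  simp

/-- The identification of the tangent space with `ℂ[w] / (K)`. -/
noncomputable def tangentEquiv {p : Coord ℓ r n} (hp : p ∈ hurwitzDomain ℓ r n) :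
    Coord ℓ r n ≃ₗ[ℂ] AdjoinRoot (criticalPoly p) :=
  LinearEquiv.ofBijective (tangentClass p) (tangentClass_bijective hp)

lemma tangentEquiv_apply {p : Coord ℓ r n} (hp : p ∈ hurwitzDomain ℓ r n) (Y : Coord ℓ r n) :
    tangentEquiv hp Y = AdjoinRoot.mk (criticalPoly p) (tangentPoly p Y) := rfl

/-- The Frobenius pairing is nondegenerate. -/
lemma eq_of_pairing_eq (hr : 1 ≤ r) {p : Coord ℓ r n} (hp : p ∈ hurwitzDomain ℓ r n)
    {Y Y' : Coord ℓ r n} (h : ∀ Z, pairing p Y Z = pairing p Y' Z) : Y = Y' := by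
  have hK := criticalPoly_ne_zero p
  have hV : ∀ x ∈ (criticalPoly p).roots.toFinset, (X * tangentDenom p).eval x ≠ 0 := by
    intro x hx
    have hD := eval_denominator_ne_zero_of_isRoot hr hp (w := x) (by simpa [hK] using hx)
    rw [eval_mul, eval_X]
    exact mul_ne_zero ((eval_denominator_ne_zero_iff hr p x).1 hD).1
      (eval_tangentDenom_ne_zero hr p hD)
  have hVK : X * tangentDenom p * criticalPoly p ≠ 0 :=
    mul_ne_zero (mul_ne_zero X_ne_zero (mul_ne_zero (pow_ne_zero _ X_ne_zero)
      (pow_ne_zero _ (monic_poleFactor p).ne_zero))) hK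
  have hadd : ∀ Z, pairing p Y Z = pairing p (Y - Y') Z + pairing p Y' Z := by
    intro Z
    rw [pairing_eq hr hp, pairing_eq hr hp, pairing_eq hr hp, ← Finset.sum_add_distrib]
    refine Finset.sum_congr rfl fun x _ => ?_
    rw [← ratResidue_add _ _ hVK, ← add_mul, ← map_add, sub_add_cancel]
  have hdvd : criticalPoly p ∣ tangentPoly p (Y - Y') := by
    refine dvd_of_sum_ratResidue_eq_zero hK hV fun H => ?_
    -- Any `H` is congruent modulo `K` to some `G_Z`, and the residues at roots of `K` see only that
    -- class.
    obtain ⟨Z, hZ⟩ := (tangentClass_bijective hp).2 (AdjoinRoot.mk _ H)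
    rw [tangentClass_apply, AdjoinRoot.mk_eq_mk] at hZ
    have h0 : pairing p (Y - Y') Z = 0 := by
      have h1 := hadd Z
      rw [h Z] at h1
      simpa using h1
    rw [← h0, pairing_eq hr hp]
    refine Finset.sum_congr rfl fun x hx => ratResidue_congr_of_dvd hK (hV x hx) (hV x hx) ?_
    have := (dvd_neg.2 hZ).mul_left (tangentPoly p (Y - Y') * (X * tangentDenom p))
    refine this.trans (dvd_of_eq (by ring))
  have h0 := eq_zero_of_dvd_of_degree_lt hdvd (degree_tangentPoly_lt p _)
  exact sub_eq_zero.1 (tangentPoly_injective hp (h0.trans (map_zero _).symm))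

/-! ### The product and its unity -/

lemma tangentPoly_unityField (p : Coord ℓ r n) :
    tangentPoly p (unityField p) = tangentDenom p := by
  have h1 : (unityField p).2 = 0 := by
    simp [unityField, partialA, Prod.snd_sum]
  have hA : ∀ k : Fin (ℓ + r + n + 1), ofCoeffs _ (partialA k : Coord ℓ r n).1 = X ^ (k : ℕ) := by
    intro k
    rw [ofCoeffs_apply, Finset.sum_eq_single k]
    · simp [partialA]
    · intro j _ hj
      simp [partialA, hj]
    · simp
  -- The unity field moves the numerator of `λ` in the direction of its denominator, which is why it
  -- differentiates `λ` to `1`.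
  have h2 : ofCoeffs _ (unityField p).1 = X ^ r * poleFactor p := by
    rw [unityField, Prod.fst_add, Prod.fst_sum, map_add, map_sum, hA, poleFactor, mul_add,
      Finset.mul_sum, pow_add]
    refine congrArg _ (Finset.sum_congr rfl fun j _ => ?_)
    rw [Prod.smul_fst, map_smul, hA, smul_eq_C_mul, pow_add]
    ring
  rw [tangentPoly_apply, h1, h2, map_zero, mul_zero, sub_zero, tangentDenom]
  ring

/-- The zeros of `w^r Q²` are poles of `λ`, so it shares no root with `K`; over `ℂ` this is
coprimality. -/
lemma isUnit_mk_tangentDenom (hr : 1 ≤ r) {p : Coord ℓ r n} (hp : p ∈ hurwitzDomain ℓ r n) :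
    ∃ s, AdjoinRoot.mk (criticalPoly p) (tangentDenom p) * s = 1 := by
  have hcop : IsCoprime (criticalPoly p) (tangentDenom p) := by
    refine (isCoprime_iff_aeval_ne_zero_of_isAlgClosed ℂ ℂ _ _).2 fun w => ?_
    by_cases hw : (criticalPoly p).eval w = 0
    · right
      simpa [coe_aeval_eq_eval] using
        eval_tangentDenom_ne_zero hr p (eval_denominator_ne_zero_of_isRoot hr hp hw)
    · left
      simpa [coe_aeval_eq_eval] using hw
  obtain ⟨a, b, hab⟩ := hcop
  refine ⟨AdjoinRoot.mk _ b, ?_⟩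
  rw [← map_mul, ← map_one (AdjoinRoot.mk (criticalPoly p)), ← hab, AdjoinRoot.mk_eq_mk]
  exact ⟨-a, by ring⟩

/-- A Frobenius product is the product of `ℂ[w] / (K)`, twisted by `(w^r Q^2)⁻¹`. -/
lemma isFrobeniusProduct_iff (hr : 1 ≤ r) {p : Coord ℓ r n} (hp : p ∈ hurwitzDomain ℓ r n)
    {s : AdjoinRoot (criticalPoly p)} (hs : AdjoinRoot.mk (criticalPoly p) (tangentDenom p) * s = 1)
    (mul : Coord ℓ r n →ₗ[ℂ] Coord ℓ r n →ₗ[ℂ] Coord ℓ r n) :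
    IsFrobeniusProduct p mul ↔
      ∀ Y Z, tangentEquiv hp (mul Y Z) = tangentEquiv hp Y * tangentEquiv hp Z * s := by
  have hK := criticalPoly_ne_zero p
  -- The residues agree root by root, because `U G_W ≡ G_Y G_Z` modulo `K`. Nondegeneracy then gives
  -- the converse.
  have suff : ∀ Y Z W, tangentEquiv hp W = tangentEquiv hp Y * tangentEquiv hp Z * s →
      ∀ T, pairing p W T = threePoint p Y Z T := by
    intro Y Z W hW T
    rw [pairing_eq hr hp, threePoint_eq hr hp]
    refine Finset.sum_congr rfl fun x hx => ?_
    have hD := eval_denominator_ne_zero_of_isRoot hr hp (w := x) (by simpa [hK] using hx)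
    have h0 := ((eval_denominator_ne_zero_iff hr p x).1 hD).1
    have hu := eval_tangentDenom_ne_zero hr p hD
    refine ratResidue_congr_of_dvd hK (by simp [h0, hu]) (by simp [h0, hu]) ?_
    rw [← AdjoinRoot.mk_eq_zero]
    simp only [tangentEquiv_apply] at hW
    simp only [map_sub, map_mul, map_pow, hW]
    linear_combination (AdjoinRoot.mk (criticalPoly p) (tangentPoly p Y) *
      AdjoinRoot.mk _ (tangentPoly p Z) * AdjoinRoot.mk _ (tangentPoly p T) *
      AdjoinRoot.mk _ X * AdjoinRoot.mk _ (tangentDenom p)) * hs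
  refine ⟨fun h Y Z => ?_, fun h Y Z T => suff Y Z _ (h Y Z) T⟩
  obtain ⟨W, hW⟩ := (tangentEquiv hp).surjective (tangentEquiv hp Y * tangentEquiv hp Z * s)
  rw [← hW]
  congr 1
  exact eq_of_pairing_eq hr hp fun T => (h Y Z T).trans (suff Y Z W hW T).symm

lemma existsUnique_isFrobeniusProduct (hr : 1 ≤ r) {p : Coord ℓ r n}
    (hp : p ∈ hurwitzDomain ℓ r n) : ∃! mul, IsFrobeniusProduct p mul := by
  obtain ⟨s, hs⟩ := isUnit_mk_tangentDenom hr hp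
  refine ⟨LinearMap.mk₂ ℂ
    (fun Y Z => (tangentEquiv hp).symm (tangentEquiv hp Y * tangentEquiv hp Z * s))
    ?_ ?_ ?_ ?_, (isFrobeniusProduct_iff hr hp hs _).2 fun Y Z => ?_, fun m hm => ?_⟩
  · intro Y Y' Z
    rw [← map_add, map_add (tangentEquiv hp) Y, add_mul, add_mul]
  · intro c Y Z
    rw [← map_smul, map_smul (tangentEquiv hp) c, smul_mul_assoc, smul_mul_assoc]
  · intro Y Z Z'
    rw [← map_add, map_add (tangentEquiv hp) Z, mul_add, add_mul]
  · intro c Y Z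
    rw [← map_smul, map_smul (tangentEquiv hp) c, mul_smul_comm, smul_mul_assoc]
  · rw [LinearMap.mk₂_apply, LinearEquiv.apply_symm_apply]
  · refine LinearMap.ext₂ fun Y Z => ?_
    rw [LinearMap.mk₂_apply, LinearEquiv.eq_symm_apply]
    exact (isFrobeniusProduct_iff hr hp hs _).1 hm Y Z

lemma isUnity_iff (hr : 1 ≤ r) {p : Coord ℓ r n} (hp : p ∈ hurwitzDomain ℓ r n)
    {mul : Coord ℓ r n →ₗ[ℂ] Coord ℓ r n →ₗ[ℂ] Coord ℓ r n} (h : IsFrobeniusProduct p mul)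
    (Y : Coord ℓ r n) : (∀ Z, mul Y Z = Z ∧ mul Z Y = Z) ↔ Y = unityField p := by
  obtain ⟨s, hs⟩ := isUnit_mk_tangentDenom hr hp
  have hmul := (isFrobeniusProduct_iff hr hp hs _).1 h
  have hu : tangentEquiv hp (unityField p) = AdjoinRoot.mk _ (tangentDenom p) := by
    rw [tangentEquiv_apply, tangentPoly_unityField]
  have hunit : ∀ Z, mul (unityField p) Z = Z ∧ mul Z (unityField p) = Z := fun Z =>
    ⟨(tangentEquiv hp).injective (by rw [hmul, hu]; linear_combination tangentEquiv hp Z * hs),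
      (tangentEquiv hp).injective (by rw [hmul, hu]; linear_combination tangentEquiv hp Z * hs)⟩
  refine ⟨fun hY => (hunit Y).2.symm.trans (hY _).1, ?_⟩
  rintro rfl
  exact hunit

lemma lieSuperpotential_eq_one_iff (hr : 1 ≤ r) {p : Coord ℓ r n} (hp : p ∈ hurwitzDomain ℓ r n)
    (Y : Coord ℓ r n) :
    (∀ w : ℂ, (denominator p).eval w ≠ 0 → lieSuperpotential p Y w = 1) ↔ Y = unityField p := by
  have key : ∀ w : ℂ, (denominator p).eval w ≠ 0 → (lieSuperpotential p Y w = 1 ↔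
      (tangentPoly p Y).eval w = (tangentDenom p).eval w) := by
    intro w hw
    have hu := eval_tangentDenom_ne_zero hr p hw
    rw [lieSuperpotential_eq hr p Y hw, ← eval_tangentDenom, div_eq_one_iff_eq hu]
  refine ⟨fun h => tangentPoly_injective hp ?_, ?_⟩
  · rw [tangentPoly_unityField]
    -- Multiplying by the denominator makes both sides vanish at the poles, so agreement off the
    -- poles becomes agreement everywhere.
    refine mul_right_cancel₀ (monic_denominator p).ne_zero (Polynomial.funext fun w => ?_)
    rw [eval_mul, eval_mul]
    by_cases hw : (denominator p).eval w = 0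
    · rw [hw, mul_zero, mul_zero]
    · rw [(key w hw).1 (h w hw)]
  · rintro rfl w hw
    rw [key w hw, tangentPoly_unityField]

/-! ### Pole orders of quotients of coprime polynomials -/

lemma poleOrder_infty (f : RatFunc ℂ) :
    poleOrder f OnePoint.infty = f.num.natDegree - f.denom.natDegree := by
  change f.intDegree.toNat = _
  rw [RatFunc.intDegree]
  omega

lemma poleOrder_coe (f : RatFunc ℂ) (x : ℂ) :
    poleOrder f (x : OnePoint ℂ) = f.denom.rootMultiplicity x := rfl

/-- The cross-multiplied form compares degrees and divisors of `A / B` with those of the reduced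
fraction. -/
lemma num_mul_eq {A B : ℂ[X]} (hB : B ≠ 0) {f : RatFunc ℂ}
    (hf : f = algebraMap ℂ[X] (RatFunc ℂ) A / algebraMap ℂ[X] (RatFunc ℂ) B) :
    f.num * B = A * f.denom := by
  have h := RatFunc.num_div_denom f
  have hB' := RatFunc.algebraMap_ne_zero hB
  have hD' := RatFunc.algebraMap_ne_zero (RatFunc.denom_ne_zero f)
  nth_rw 3 [hf] at h
  rw [div_eq_div_iff hD' hB', ← map_mul, ← map_mul] at h
  exact RatFunc.algebraMap_injective ℂ h

lemma poleOrder_coe_div {A B : ℂ[X]} (hAB : IsCoprime A B) (hB : B ≠ 0) (x : ℂ) :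
    poleOrder (algebraMap ℂ[X] (RatFunc ℂ) A / algebraMap ℂ[X] (RatFunc ℂ) B) (x : OnePoint ℂ) =
      B.rootMultiplicity x := by
  set f := algebraMap ℂ[X] (RatFunc ℂ) A / algebraMap ℂ[X] (RatFunc ℂ) B with hf
  have h := num_mul_eq hB hf
  have h1 : f.denom ∣ B :=
    (RatFunc.isCoprime_num_denom f).symm.dvd_of_dvd_mul_left (Dvd.intro_left _ h.symm)
  have h2 : B ∣ f.denom := hAB.symm.dvd_of_dvd_mul_left (Dvd.intro_left _ h)
  exact le_antisymm (rootMultiplicity_le_rootMultiplicity_of_dvd hB h1 x)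
    (rootMultiplicity_le_rootMultiplicity_of_dvd (RatFunc.denom_ne_zero f) h2 x)

lemma poleOrder_infty_div {A B : ℂ[X]} (hA : A ≠ 0) (hB : B ≠ 0) :
    poleOrder (algebraMap ℂ[X] (RatFunc ℂ) A / algebraMap ℂ[X] (RatFunc ℂ) B) OnePoint.infty =
      A.natDegree - B.natDegree := by
  set f := algebraMap ℂ[X] (RatFunc ℂ) A / algebraMap ℂ[X] (RatFunc ℂ) B with hf
  have h := num_mul_eq hB hf
  have hf0 : f.num ≠ 0 := by
    intro h0
    rw [h0, zero_mul] at h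
    exact mul_ne_zero hA (RatFunc.denom_ne_zero f) h.symm
  have h' := congrArg natDegree h
  rw [natDegree_mul hf0 hB, natDegree_mul hA (RatFunc.denom_ne_zero f)] at h'
  rw [poleOrder_infty]
  omega

/-! ### Composition with Möbius transformations -/

lemma moebius_denom_ne_zero (g : GL (Fin 2) ℂ) :
    RatFunc.C (g 1 0) * RatFunc.X + RatFunc.C (g 1 1) ≠ (0 : RatFunc ℂ) := by
  intro h
  have h' : algebraMap ℂ[X] (RatFunc ℂ) (C (g 1 0) * X + C (g 1 1)) = 0 := by
    simpa [RatFunc.algebraMap_C] using h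
  rw [map_eq_zero_iff _ (RatFunc.algebraMap_injective ℂ)] at h'
  have h0 := congrArg (coeff · 0) h'
  have h1 := congrArg (coeff · 1) h'
  simp [coeff_C] at h0 h1
  refine g.det_ne_zero ?_
  rw [Matrix.det_fin_two, h0, h1]
  ring

/-- A constant value would make the rows of the matrix proportional. Transcendence is what lets
composition extend from polynomials to a ring homomorphism on `RatFunc ℂ`. -/
lemma transcendental_moebius (g : GL (Fin 2) ℂ) : Transcendental ℂ (moebius g) := by
  refine RatFunc.transcendental_of_ne_C _ ?_
  rintro ⟨c, hc⟩
  rw [moebius, div_eq_iff (moebius_denom_ne_zero g)] at hc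
  have h' : algebraMap ℂ[X] (RatFunc ℂ) (C (g 0 0) * X + C (g 0 1)) =
      algebraMap ℂ[X] (RatFunc ℂ) (C c * (C (g 1 0) * X + C (g 1 1))) := by
    simpa [RatFunc.algebraMap_C] using hc
  have h := RatFunc.algebraMap_injective ℂ h'
  have h0 := congrArg (coeff · 0) h
  have h1 := congrArg (coeff · 1) h
  simp [coeff_C, mul_add] at h0 h1
  refine g.det_ne_zero ?_
  rw [Matrix.det_fin_two, h0, h1]
  ring

lemma eval₂_moebius_injective (g : GL (Fin 2) ℂ) :
    Function.Injective (eval₂RingHom (RatFunc.C (K := ℂ)) (moebius g)) := by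
  have h := transcendental_iff_injective.1 (transcendental_moebius g)
  intro P P' hP
  refine h ?_
  rw [aeval_def, aeval_def, RatFunc.algebraMap_eq_C]
  exact hP

/-- Composition `f ↦ f ∘ g` with a Möbius transformation. -/
noncomputable def moebiusHom (g : GL (Fin 2) ℂ) : RatFunc ℂ →+* RatFunc ℂ :=
  RatFunc.liftRingHom (eval₂RingHom RatFunc.C (moebius g))
    (nonZeroDivisors_le_comap_nonZeroDivisors_of_injective _ (eval₂_moebius_injective g))

lemma moebiusHom_algebraMap (g : GL (Fin 2) ℂ) (P : ℂ[X]) :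
    moebiusHom g (algebraMap ℂ[X] (RatFunc ℂ) P) = P.eval₂ RatFunc.C (moebius g) :=
  RatFunc.liftRingHom_algebraMap _ _ P

lemma eval_moebius (g : GL (Fin 2) ℂ) (f : RatFunc ℂ) :
    RatFunc.eval RatFunc.C (moebius g) f = moebiusHom g f := by
  conv_rhs => rw [← RatFunc.num_div_denom f]
  rw [map_div₀, moebiusHom_algebraMap, moebiusHom_algebraMap]
  rfl

lemma moebiusHom_C (g : GL (Fin 2) ℂ) (c : ℂ) : moebiusHom g (RatFunc.C c) = RatFunc.C c := by
  rw [← RatFunc.algebraMap_C, moebiusHom_algebraMap, eval₂_C, RatFunc.algebraMap_C]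

lemma moebiusHom_X (g : GL (Fin 2) ℂ) : moebiusHom g RatFunc.X = moebius g := by
  rw [← RatFunc.algebraMap_X, moebiusHom_algebraMap, eval₂_X]

lemma moebius_mul (g h : GL (Fin 2) ℂ) : moebius (g * h) = moebiusHom h (moebius g) := by
  have h1 := moebius_denom_ne_zero (g * h)
  have h2 := moebius_denom_ne_zero h
  have h3 : moebiusHom h (RatFunc.C (g 1 0) * RatFunc.X + RatFunc.C (g 1 1)) ≠ 0 :=
    (_root_.map_ne_zero _).2 (moebius_denom_ne_zero g)
  rw [moebius, moebius, map_div₀, div_eq_div_iff h1 h3]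
  simp only [map_add, map_mul, moebiusHom_C, moebiusHom_X, Units.val_mul,
    Matrix.mul_apply, Fin.sum_univ_two, moebius]
  field_simp
  ring

lemma moebiusHom_mul (g h : GL (Fin 2) ℂ) (f : RatFunc ℂ) :
    moebiusHom (g * h) f = moebiusHom h (moebiusHom g f) := by
  have key : ∀ P : ℂ[X], moebiusHom (g * h) (algebraMap ℂ[X] (RatFunc ℂ) P) =
      moebiusHom h (moebiusHom g (algebraMap ℂ[X] (RatFunc ℂ) P)) := by
    intro P
    have hC : (moebiusHom h).comp RatFunc.C = RatFunc.C := RingHom.ext (moebiusHom_C h)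
    rw [moebiusHom_algebraMap, moebiusHom_algebraMap, hom_eval₂, ← moebius_mul, hC]
  rw [← RatFunc.num_div_denom f]
  simp only [map_div₀, key]

/-- Composition with the Möbius transformation `g` transports pole orders along `g`. -/
def TransportsPoles (g : GL (Fin 2) ℂ) : Prop :=
  ∀ f : RatFunc ℂ, f ≠ 0 → ∀ x : OnePoint ℂ, poleOrder (moebiusHom g f) x = poleOrder f (g • x)

lemma TransportsPoles.mul {g h : GL (Fin 2) ℂ} (hg : TransportsPoles g) (hh : TransportsPoles h) :
    TransportsPoles (g * h) := fun f hf x => by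
  rw [moebiusHom_mul, hh _ ((_root_.map_ne_zero _).2 hf), hg f hf, mul_smul]

lemma TransportsPoles.isHurwitzDatum {g : GL (Fin 2) ℂ} (hg : TransportsPoles g) {f : RatFunc ℂ}
    (hf0 : f ≠ 0) {P Q : OnePoint ℂ} (hf : IsHurwitzDatum ℓ r n f (g • P) (g • Q)) :
    IsHurwitzDatum ℓ r n (moebiusHom g f) P Q := by
  classical
  obtain ⟨hne, hi, hz, S, hS, hPS, hQS, h1, h0⟩ := hf
  have hmem : ∀ x, x ∈ S.image (g⁻¹ • ·) ↔ g • x ∈ S := by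
    intro x
    rw [Finset.mem_image]
    constructor
    · rintro ⟨y, hy, rfl⟩
      simpa using hy
    · exact fun h => ⟨_, h, inv_smul_smul g x⟩
  refine ⟨fun h => hne (by rw [h]), by rw [hg f hf0, hi], by rw [hg f hf0, hz],
    S.image (g⁻¹ • ·), ?_, by rwa [hmem], by rwa [hmem], fun x hx => ?_, fun x hx hxP hxQ => ?_⟩
  · rw [Finset.card_image_of_injective _ (MulAction.injective g⁻¹), hS]
  · rw [hg f hf0, h1 _ ((hmem x).1 hx)]
  · rw [hg f hf0, h0 _ (fun h => hx ((hmem x).2 h))]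
    · exact fun h => hxP (MulAction.injective g h)
    · exact fun h => hxQ (MulAction.injective g h)

/-! ### Affine maps and inversion transport poles -/

/-- The affine transformation `w ↦ a w + b`. -/
noncomputable def affineMoebius (a b : ℂ) (ha : a ≠ 0) : GL (Fin 2) ℂ :=
  Matrix.GeneralLinearGroup.mkOfDetNeZero !![a, b; 0, 1] (by simpa [Matrix.det_fin_two] using ha)

/-- The inversion `w ↦ 1 / w`. -/
noncomputable def inversion : GL (Fin 2) ℂ :=
  Matrix.GeneralLinearGroup.mkOfDetNeZero !![0, 1; 1, 0] (by simp [Matrix.det_fin_two])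

lemma affineMoebius_smul_infty (a b : ℂ) (ha : a ≠ 0) :
    affineMoebius a b ha • (OnePoint.infty : OnePoint ℂ) = OnePoint.infty := by
  rw [OnePoint.smul_infty_eq_self_iff]
  simp [affineMoebius, Matrix.GeneralLinearGroup.mkOfDetNeZero]

lemma affineMoebius_smul_coe (a b : ℂ) (ha : a ≠ 0) (x : ℂ) :
    affineMoebius a b ha • (x : OnePoint ℂ) = ((a * x + b : ℂ) : OnePoint ℂ) := by
  rw [OnePoint.smul_some_eq_ite]
  simp [affineMoebius, Matrix.GeneralLinearGroup.mkOfDetNeZero]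

lemma inversion_smul_infty : inversion • (OnePoint.infty : OnePoint ℂ) = ((0 : ℂ) : OnePoint ℂ) := by
  rw [OnePoint.smul_infty_eq_ite]
  simp [inversion, Matrix.GeneralLinearGroup.mkOfDetNeZero]

lemma inversion_smul_zero : inversion • ((0 : ℂ) : OnePoint ℂ) = OnePoint.infty := by
  rw [OnePoint.smul_some_eq_ite]
  simp [inversion, Matrix.GeneralLinearGroup.mkOfDetNeZero]

lemma inversion_smul_coe {x : ℂ} (hx : x ≠ 0) :
    inversion • (x : OnePoint ℂ) = ((x⁻¹ : ℂ) : OnePoint ℂ) := by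
  rw [OnePoint.smul_some_eq_ite]
  simp [inversion, Matrix.GeneralLinearGroup.mkOfDetNeZero, hx]

lemma moebius_affineMoebius (a b : ℂ) (ha : a ≠ 0) :
    moebius (affineMoebius a b ha) = algebraMap ℂ[X] (RatFunc ℂ) (C a * X + C b) := by
  simp [moebius, affineMoebius, Matrix.GeneralLinearGroup.mkOfDetNeZero, RatFunc.algebraMap_C]

lemma moebius_inversion : moebius inversion = (RatFunc.X : RatFunc ℂ)⁻¹ := by
  simp [moebius, inversion, Matrix.GeneralLinearGroup.mkOfDetNeZero]

lemma moebiusHom_affineMoebius (a b : ℂ) (ha : a ≠ 0) (P : ℂ[X]) :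
    moebiusHom (affineMoebius a b ha) (algebraMap ℂ[X] (RatFunc ℂ) P) =
      algebraMap ℂ[X] (RatFunc ℂ) (P.comp (C a * X + C b)) := by
  rw [moebiusHom_algebraMap, moebius_affineMoebius, comp, hom_eval₂, RatFunc.algebraMap_comp_C]

lemma transportsPoles_affineMoebius (a b : ℂ) (ha : a ≠ 0) :
    TransportsPoles (affineMoebius a b ha) := by
  intro f hf x
  have hlin : (C a * X + C b).natDegree ≠ 0 := by rw [natDegree_linear ha]; exact one_ne_zero
  have hcomp : ∀ P : ℂ[X], P ≠ 0 → P.comp (C a * X + C b) ≠ 0 := by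
    intro P hP h
    rw [comp_eq_zero_iff] at h
    refine h.elim hP fun h => hlin ?_
    rw [h.2, natDegree_C]
  have heq : moebiusHom (affineMoebius a b ha) f =
      algebraMap ℂ[X] (RatFunc ℂ) (f.num.comp (C a * X + C b)) /
        algebraMap ℂ[X] (RatFunc ℂ) (f.denom.comp (C a * X + C b)) := by
    conv_lhs => rw [← RatFunc.num_div_denom f]
    rw [map_div₀, moebiusHom_affineMoebius, moebiusHom_affineMoebius]
  rw [heq]
  induction x using OnePoint.rec with
  | infty =>
    rw [affineMoebius_smul_infty, poleOrder_infty_div (hcomp _ (RatFunc.num_ne_zero hf))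
      (hcomp _ (RatFunc.denom_ne_zero f)), poleOrder_infty, natDegree_comp, natDegree_comp,
      natDegree_linear ha, mul_one, mul_one]
  | coe x =>
    have hcop : IsCoprime (f.num.comp (C a * X + C b)) (f.denom.comp (C a * X + C b)) :=
      (RatFunc.isCoprime_num_denom f).map (compRingHom (C a * X + C b))
    rw [affineMoebius_smul_coe, poleOrder_coe_div hcop (hcomp _ (RatFunc.denom_ne_zero f)), poleOrder_coe,
      rootMultiplicity_comp_C_mul_X_add_C _ _ _ _ ha.isUnit]

lemma eval_reverse_eq_zero_iff (P : ℂ[X]) {z : ℂ} (hz : z ≠ 0) :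
    P.reverse.eval z = 0 ↔ P.eval z⁻¹ = 0 := by
  let : Invertible z⁻¹ := invertibleOfNonzero (inv_ne_zero hz)
  have := eval₂_reverse_eq_zero_iff (RingHom.id ℂ) z⁻¹ P
  rwa [invOf_eq_inv, inv_inv, ← eval, ← eval] at this

/-- Reversal is multiplicative and sends `X - z⁻¹` to a unit times `X - z`; the cofactor stays
nonzero at `z`. -/
lemma rootMultiplicity_reverse {P : ℂ[X]} (hP : P ≠ 0) {z : ℂ} (hz : z ≠ 0) :
    P.reverse.rootMultiplicity z = P.rootMultiplicity z⁻¹ := by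
  obtain ⟨E, hE, hEz⟩ := exists_eq_pow_rootMultiplicity_mul_and_not_dvd P hP z⁻¹
  set k := P.rootMultiplicity z⁻¹
  have hlin : (X - C z⁻¹).reverse = C (-z⁻¹) * (X - C z) := by
    have hX : (X : ℂ[X]).reverse = 1 := by
      rw [← mul_one X, reverse_X_mul, ← C_1, reverse_C]
    have hz1 : (C z⁻¹ * C z : ℂ[X]) = 1 := by rw [← C_mul, inv_mul_cancel₀ hz, C_1]
    rw [sub_eq_add_neg, ← C_neg, reverse_add_C, natDegree_X, pow_one, hX, C_neg]
    linear_combination -hz1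
  have hpow : ∀ m : ℕ, ((X - C z⁻¹) ^ m).reverse = (C (-z⁻¹) * (X - C z)) ^ m := by
    intro m
    induction m with
    | zero => rw [pow_zero, pow_zero, ← C_1, reverse_C]
    | succ m ih => rw [pow_succ, reverse_mul_of_domain, ih, hlin, pow_succ]
  have hE0 : E ≠ 0 := by rintro rfl; simp at hEz
  have hEr : E.reverse.eval z ≠ 0 := by
    rw [Ne, eval_reverse_eq_zero_iff E hz]
    exact fun h => hEz (dvd_iff_isRoot.2 h)
  have hrev : P.reverse = (X - C z) ^ k * (C ((-z⁻¹) ^ k) * E.reverse) := by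
    rw [hE, reverse_mul_of_domain, hpow, mul_pow, ← C_pow]
    ring
  have hW : ((C ((-z⁻¹) ^ k) * E.reverse : ℂ[X])).eval z ≠ 0 := by
    rw [eval_mul, eval_C]
    exact mul_ne_zero (pow_ne_zero _ (neg_ne_zero.2 (inv_ne_zero hz))) hEr
  rw [hrev, rootMultiplicity_mul, rootMultiplicity_X_sub_C_pow, rootMultiplicity_eq_zero hW,
    add_zero]
  rw [← hrev]
  exact reverse_eq_zero.not.2 hP

lemma moebiusHom_inversion (P : ℂ[X]) :
    moebiusHom inversion (algebraMap ℂ[X] (RatFunc ℂ) P) =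
      algebraMap ℂ[X] (RatFunc ℂ) P.reverse / RatFunc.X ^ P.natDegree := by
  let : Invertible (RatFunc.X : RatFunc ℂ)⁻¹ :=
    invertibleOfNonzero (inv_ne_zero RatFunc.X_ne_zero)
  rw [moebiusHom_algebraMap, moebius_inversion, ← eval₂_reverse_mul_pow, invOf_eq_inv, inv_inv,
    inv_pow, div_eq_mul_inv, ← RatFunc.algebraMap_eq_C, ← aeval_def,
    RatFunc.aeval_X_left_eq_algebraMap]

lemma transportsPoles_inversion : TransportsPoles inversion := by
  intro f hf x
  have hN := RatFunc.num_ne_zero hf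
  have hD := RatFunc.denom_ne_zero f
  have hcop := RatFunc.isCoprime_num_denom f
  set N := f.num
  set D := f.denom
  -- Here `f(1/w) = w^{deg D - deg N} N.reverse / D.reverse`. Truncated subtraction puts the power
  -- of `w` on the side where its exponent is nonnegative.
  set A := X ^ (D.natDegree - N.natDegree) * N.reverse
  set B := X ^ (N.natDegree - D.natDegree) * D.reverse
  have hNr : N.reverse ≠ 0 := reverse_eq_zero.not.2 hN
  have hDr : D.reverse ≠ 0 := reverse_eq_zero.not.2 hD
  have hA : A ≠ 0 := mul_ne_zero (pow_ne_zero _ X_ne_zero) hNr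
  have hB : B ≠ 0 := mul_ne_zero (pow_ne_zero _ X_ne_zero) hDr
  have heval0 : ∀ P : ℂ[X], P ≠ 0 → P.reverse.eval 0 ≠ 0 := by
    intro P hP
    rw [← coeff_zero_eq_eval_zero, coeff_zero_reverse]
    exact leadingCoeff_ne_zero.2 hP
  have hcomm : ∀ w, N.eval w = 0 → D.eval w ≠ 0 := by
    intro w h1 h2
    obtain ⟨a, b, hab⟩ := hcop
    have := congrArg (eval w) hab
    simp [h1, h2] at this
  have heq : moebiusHom inversion f =
      algebraMap ℂ[X] (RatFunc ℂ) A / algebraMap ℂ[X] (RatFunc ℂ) B := by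
    conv_lhs => rw [← RatFunc.num_div_denom f]
    rw [map_div₀, moebiusHom_inversion, moebiusHom_inversion]
    have hX := RatFunc.X_ne_zero (K := ℂ)
    have hDr' := RatFunc.algebraMap_ne_zero hDr
    simp only [A, B, map_mul, map_pow, RatFunc.algebraMap_X]
    change algebraMap ℂ[X] (RatFunc ℂ) N.reverse / RatFunc.X ^ N.natDegree /
      (algebraMap ℂ[X] (RatFunc ℂ) D.reverse / RatFunc.X ^ D.natDegree) = _
    have hpow : (RatFunc.X : RatFunc ℂ) ^ (N.natDegree - D.natDegree) * RatFunc.X ^ D.natDegree =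
        RatFunc.X ^ (D.natDegree - N.natDegree) * RatFunc.X ^ N.natDegree := by
      rw [← pow_add, ← pow_add]
      congr 1
      omega
    rw [div_div_div_eq, div_eq_div_iff (mul_ne_zero (pow_ne_zero _ hX) hDr')
      (mul_ne_zero (pow_ne_zero _ hX) hDr')]
    linear_combination (algebraMap ℂ[X] (RatFunc ℂ) N.reverse *
      algebraMap ℂ[X] (RatFunc ℂ) D.reverse) * hpow
  have hAB : IsCoprime A B := by
    refine (isCoprime_iff_aeval_ne_zero_of_isAlgClosed ℂ ℂ _ _).2 fun w => ?_
    simp only [coe_aeval_eq_eval]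
    by_cases hw : w = 0
    · subst hw
      rcases le_total N.natDegree D.natDegree with h | h
      · right
        simpa [B, Nat.sub_eq_zero_of_le h] using heval0 D hD
      · left
        simpa [A, Nat.sub_eq_zero_of_le h] using heval0 N hN
    · by_contra! h
      simp only [A, B, eval_mul, eval_pow, eval_X, mul_eq_zero, pow_eq_zero_iff', hw, false_and,
        false_or, eval_reverse_eq_zero_iff _ hw] at h
      exact hcomm _ h.1 h.2
  have hmB : ∀ z : ℂ, B.rootMultiplicity z =
      (X ^ (N.natDegree - D.natDegree) : ℂ[X]).rootMultiplicity z +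
        D.reverse.rootMultiplicity z := fun z => rootMultiplicity_mul hB
  rw [heq]
  induction x using OnePoint.rec with
  | infty =>
    rw [inversion_smul_infty, poleOrder_infty_div hA hB, poleOrder_coe,
      natDegree_mul (pow_ne_zero _ X_ne_zero) hNr, natDegree_mul (pow_ne_zero _ X_ne_zero) hDr,
      natDegree_X_pow, natDegree_X_pow, reverse_natDegree, reverse_natDegree,
      rootMultiplicity_eq_natTrailingDegree']
    change _ = D.natTrailingDegree
    have h1 := N.natTrailingDegree_le_natDegree
    have h2 := D.natTrailingDegree_le_natDegree
    -- Trailing degrees are the vanishing orders at `0`, and the coprime `N`, `D` do not both vanish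
    -- there. So the truncated difference of degrees is the order of `D`.
    have h3 : N.natTrailingDegree = 0 ∨ D.natTrailingDegree = 0 := by
      by_contra! h
      refine hcomm 0 ?_ ?_
      · rw [← coeff_zero_eq_eval_zero]
        exact coeff_eq_zero_of_lt_natTrailingDegree (Nat.pos_of_ne_zero h.1)
      · rw [← coeff_zero_eq_eval_zero]
        exact coeff_eq_zero_of_lt_natTrailingDegree (Nat.pos_of_ne_zero h.2)
    omega
  | coe z =>
    rw [poleOrder_coe_div hAB hB, hmB]
    by_cases hz : z = 0
    · subst hz
      rw [inversion_smul_zero, poleOrder_infty, rootMultiplicity_eq_zero (heval0 D hD), add_zero]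
      have := rootMultiplicity_X_sub_C_pow (0 : ℂ) (N.natDegree - D.natDegree)
      rwa [C_0, sub_zero] at this
    · rw [inversion_smul_coe hz, poleOrder_coe, rootMultiplicity_reverse hD hz,
        rootMultiplicity_eq_zero (by simp [hz]), zero_add]

/-- Two distinct points of the sphere are the images of `∞` and `0` under a product of affine
transformations and inversions. -/
lemma exists_transportsPoles {P Q : OnePoint ℂ} (hPQ : P ≠ Q) :
    ∃ g : GL (Fin 2) ℂ, TransportsPoles g ∧ g • (OnePoint.infty : OnePoint ℂ) = P ∧
      g • ((0 : ℂ) : OnePoint ℂ) = Q := by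
  obtain ⟨h, hh, hP⟩ : ∃ h : GL (Fin 2) ℂ, TransportsPoles h ∧
      h • (OnePoint.infty : OnePoint ℂ) = P := by
    induction P using OnePoint.rec with
    | infty => exact ⟨_, transportsPoles_affineMoebius 1 0 one_ne_zero,
        affineMoebius_smul_infty _ _ _⟩
    | coe x =>
      refine ⟨_, (transportsPoles_affineMoebius 1 x one_ne_zero).mul transportsPoles_inversion, ?_⟩
      rw [mul_smul, inversion_smul_infty, affineMoebius_smul_coe, mul_zero, zero_add]
  obtain ⟨y, hy⟩ : ∃ y : ℂ, (y : OnePoint ℂ) = h⁻¹ • Q := by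
    refine OnePoint.ne_infty_iff_exists.1 fun hQ => hPQ ?_
    rw [← hP, ← hQ, smul_inv_smul]
  refine ⟨h * affineMoebius 1 y one_ne_zero, hh.mul (transportsPoles_affineMoebius _ _ _), ?_, ?_⟩
  · rw [mul_smul, affineMoebius_smul_infty, hP]
  · rw [mul_smul, affineMoebius_smul_coe, mul_zero, zero_add, hy, smul_inv_smul]

/-! ### The normal form -/

lemma isHurwitzDatum_superpotentialRat {p : Coord ℓ r n} (hp : p ∈ hurwitzDomain ℓ r n) :
    IsHurwitzDatum ℓ r n (superpotentialRat p) OnePoint.infty ((0 : ℂ) : OnePoint ℂ) := by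
  classical
  obtain ⟨hcop, hsep, hQ0⟩ := hp
  have hQ := (monic_poleFactor p).ne_zero
  have hD := (monic_denominator p).ne_zero
  have hcoe : ∀ x : ℂ, poleOrder (superpotentialRat p) (x : OnePoint ℂ) =
      (X ^ r : ℂ[X]).rootMultiplicity x + (poleFactor p).rootMultiplicity x := fun x =>
    (poleOrder_coe_div hcop hD x).trans (rootMultiplicity_mul hD)
  have hnodup := (nodup_roots_iff_of_splits hQ (IsAlgClosed.splits _)).2 hsep
  refine ⟨OnePoint.infty_ne_coe _, ?_, ?_, (poleFactor p).roots.toFinset.image (↑), ?_, ?_, ?_, ?_,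
    ?_⟩
  · rw [superpotentialRat, poleOrder_infty_div (monic_numerator p).ne_zero hD, natDegree_numerator,
      natDegree_denominator]
    omega
  · have := rootMultiplicity_X_sub_C_pow (0 : ℂ) r
    rw [C_0, sub_zero] at this
    rw [hcoe, this, rootMultiplicity_eq_zero hQ0, add_zero]
  · rw [Finset.card_image_of_injective _ OnePoint.coe_injective,
      Multiset.toFinset_card_of_nodup hnodup,
      splits_iff_card_roots.1 (IsAlgClosed.splits _), natDegree_poleFactor]
  · simp
  · simpa [hQ] using hQ0
  · intro x hx
    obtain ⟨y, hy, rfl⟩ := Finset.mem_image.1 hx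
    rw [Multiset.mem_toFinset] at hy
    have hy0 : y ≠ 0 := by
      rintro rfl
      exact hQ0 ((mem_roots hQ).1 hy)
    rw [hcoe, rootMultiplicity_eq_zero (by simp [hy0]), zero_add, ← count_roots,
      Multiset.count_eq_one_of_mem hnodup hy]
  · intro x hx hxi hx0
    obtain ⟨y, rfl⟩ := OnePoint.ne_infty_iff_exists.1 hxi
    have hy0 : y ≠ 0 := by rintro rfl; exact hx0 rfl
    have hy : ¬ IsRoot (poleFactor p) y := fun h =>
      hx (Finset.mem_image_of_mem _ (by simpa [hQ] using h))
    rw [hcoe, rootMultiplicity_eq_zero (by simp [hy0]), rootMultiplicity_eq_zero hy]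

lemma X_pow_add_ofCoeffs {P : ℂ[X]} {m : ℕ} (hP : P.Monic) (hm : P.natDegree = m) :
    X ^ m + ofCoeffs m (fun k => P.coeff k) = P := by
  conv_rhs => rw [hP.as_sum, hm]
  rw [ofCoeffs_apply, Fin.sum_univ_eq_sum_range (fun i => C (P.coeff i) * X ^ i)]

/-- Splitting `w^r` off the denominator leaves `Q`, whose roots are exactly `S`. Simplicity of these
poles makes `Q` separable of degree `n`, and the order at infinity then fixes the degree of the
numerator. -/
lemma exists_eq_superpotentialRat {f : RatFunc ℂ}
    (hf : IsHurwitzDatum ℓ r n f OnePoint.infty ((0 : ℂ) : OnePoint ℂ)) (hmonic : f.num.Monic) :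
    ∃ p ∈ hurwitzDomain ℓ r n, f = superpotentialRat p := by
  classical
  obtain ⟨-, hi, hz, S, hS, hiS, hzS, h1, h0⟩ := hf
  have hD := RatFunc.denom_ne_zero f
  have hDm := RatFunc.monic_denom f
  obtain ⟨Q, hQ, hQ0⟩ := exists_eq_pow_rootMultiplicity_mul_and_not_dvd f.denom hD 0
  rw [poleOrder_coe] at hz
  rw [hz, C_0, sub_zero] at hQ
  rw [C_0, sub_zero, X_dvd_iff, coeff_zero_eq_eval_zero] at hQ0
  have hQm : Q.Monic := (monic_X_pow r).of_mul_monic_left (hQ ▸ hDm)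
  have hQne := hQm.ne_zero
  have hmult : ∀ x : ℂ, x ≠ 0 → poleOrder f (x : OnePoint ℂ) = Q.rootMultiplicity x := by
    intro x hx
    rw [poleOrder_coe, hQ, rootMultiplicity_mul (hQ ▸ hD), rootMultiplicity_eq_zero (by simp [hx]),
      zero_add]
  have hroot0 : ∀ x, x ∈ Q.roots → x ≠ 0 := by
    rintro x hx rfl
    exact hQ0 ((mem_roots hQne).1 hx)
  have hnodup : Q.roots.Nodup := by
    rw [Multiset.nodup_iff_count_le_one]
    intro x
    by_cases hx : x ∈ Q.roots
    · rw [count_roots, ← hmult x (hroot0 x hx)]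
      by_cases hxS : (x : OnePoint ℂ) ∈ S
      · exact (h1 _ hxS).le
      · rw [h0 _ hxS (OnePoint.coe_ne_infty x)
          (fun h => hroot0 x hx (OnePoint.coe_injective h))]
        exact zero_le_one
    · rw [Multiset.count_eq_zero_of_notMem hx]
      exact zero_le_one
  have hSeq : Q.roots.toFinset.image (↑) = S := by
    ext x
    rw [Finset.mem_image]
    constructor
    · rintro ⟨y, hy, rfl⟩
      rw [Multiset.mem_toFinset] at hy
      by_contra hyS
      have := h0 _ hyS (OnePoint.coe_ne_infty y)
        (fun h => hroot0 y hy (OnePoint.coe_injective h))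
      rw [hmult y (hroot0 y hy), ← count_roots, Multiset.count_eq_zero] at this
      exact this hy
    · intro hx
      obtain ⟨y, rfl⟩ := OnePoint.ne_infty_iff_exists.1 (fun h : x = _ => hiS (h ▸ hx))
      have hy0 : y ≠ 0 := by rintro rfl; exact hzS hx
      refine ⟨y, ?_, rfl⟩
      rw [Multiset.mem_toFinset, ← Multiset.one_le_count_iff_mem, count_roots, ← hmult y hy0,
        h1 _ hx]
  have hQn : Q.natDegree = n := by
    rw [← hS, ← hSeq, Finset.card_image_of_injective _ OnePoint.coe_injective,
      Multiset.toFinset_card_of_nodup hnodup, splits_iff_card_roots.1 (IsAlgClosed.splits _)]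
  have hDn : f.denom.natDegree = r + n := by
    rw [hQ, (monic_X_pow r).natDegree_mul hQm, natDegree_X_pow, hQn]
  have hNn : f.num.natDegree = ℓ + r + n + 1 := by
    rw [poleOrder_infty, hDn] at hi
    omega
  let p : Coord ℓ r n := (fun k => f.num.coeff k, fun j => Q.coeff j)
  have hpN : numerator p = f.num := X_pow_add_ofCoeffs hmonic hNn
  have hpQ : poleFactor p = Q := X_pow_add_ofCoeffs hQm hQn
  have hpD : denominator p = f.denom := by rw [denominator, hpQ, ← hQ]
  refine ⟨p, ⟨?_, ?_, ?_⟩, ?_⟩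
  · rw [hpN, hpD]
    exact RatFunc.isCoprime_num_denom f
  · rw [hpQ]
    exact (nodup_roots_iff_of_splits hQne (IsAlgClosed.splits _)).1 hnodup
  · rwa [hpQ]
  · rw [superpotentialRat, hpN, hpD, RatFunc.num_div_denom]

/-- A rescaling of the coordinate makes the numerator monic. -/
lemma exists_monic_num_scaling {f : RatFunc ℂ} (hf : poleOrder f OnePoint.infty = ℓ + 1) :
    ∃ t : ℂ, ∃ ht : t ≠ 0, (moebiusHom (affineMoebius t 0 ht) f).num.Monic := by
  rw [poleOrder_infty] at hf
  have hN : f.num ≠ 0 := by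
    intro h
    rw [h, natDegree_zero] at hf
    omega
  have hlc := leadingCoeff_ne_zero.2 hN
  -- Replacing `w` by `t w` multiplies the leading coefficient of the reduced fraction by `t^{deg N
  -- - deg D} = t^{ℓ+1}`.
  obtain ⟨t, ht⟩ := IsAlgClosed.exists_pow_nat_eq f.num.leadingCoeff⁻¹ (Nat.succ_pos ℓ)
  have ht0 : t ≠ 0 := by
    rintro rfl
    rw [zero_pow (Nat.succ_ne_zero ℓ)] at ht
    exact inv_ne_zero hlc ht.symm
  refine ⟨t, ht0, ?_⟩
  have hlin : (C t * X + C 0).natDegree ≠ 0 := by rw [natDegree_linear ht0]; exact one_ne_zero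
  have hlead : (C t * X + C 0 : ℂ[X]).leadingCoeff = t := leadingCoeff_linear ht0
  have hD := RatFunc.monic_denom f
  have hDc : f.denom.comp (C t * X + C 0) ≠ 0 := by
    rw [← leadingCoeff_ne_zero, leadingCoeff_comp hlin, hD.leadingCoeff, hlead, one_mul]
    exact pow_ne_zero _ ht0
  set F := moebiusHom (affineMoebius t 0 ht0) f with hF
  have heq : F = algebraMap ℂ[X] (RatFunc ℂ) (f.num.comp (C t * X + C 0)) /
        algebraMap ℂ[X] (RatFunc ℂ) (f.denom.comp (C t * X + C 0)) := by
    rw [hF]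
    conv_lhs => rw [← RatFunc.num_div_denom f]
    rw [map_div₀, moebiusHom_affineMoebius, moebiusHom_affineMoebius]
  have h := congrArg leadingCoeff (num_mul_eq hDc heq)
  rw [leadingCoeff_mul, leadingCoeff_mul, leadingCoeff_comp hlin, leadingCoeff_comp hlin, hlead,
    hD.leadingCoeff, (RatFunc.monic_denom F).leadingCoeff, one_mul, mul_one,
    show f.num.natDegree = (ℓ + 1) + f.denom.natDegree by omega, pow_add, ht,
    mul_inv_cancel_left₀ hlc] at h
  exact mul_right_cancel₀ (pow_ne_zero _ ht0) (h.trans (one_mul _).symm)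

lemma exists_hurwitzEquiv_superpotentialRat {f : RatFunc ℂ} {P Q : OnePoint ℂ}
    (hf : IsHurwitzDatum ℓ r n f P Q) :
    ∃ p ∈ hurwitzDomain ℓ r n, HurwitzEquiv f P Q (superpotentialRat p)
      OnePoint.infty ((0 : ℂ) : OnePoint ℂ) := by
  have hf0 : f ≠ 0 := by
    rintro rfl
    have h := hf.order_inf
    induction P using OnePoint.rec with
    | infty => simp [poleOrder_infty] at h
    | coe x => simp [poleOrder_coe, rootMultiplicity_eq_zero] at h
  obtain ⟨g, hg, rfl, rfl⟩ := exists_transportsPoles hf.ne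
  have hinf : poleOrder (moebiusHom g f) OnePoint.infty = ℓ + 1 :=
    (hg.isHurwitzDatum hf0 hf).order_inf
  obtain ⟨t, ht, hmonic⟩ := exists_monic_num_scaling hinf
  have hi := affineMoebius_smul_infty t 0 ht
  have hz : affineMoebius t 0 ht • ((0 : ℂ) : OnePoint ℂ) = ((0 : ℂ) : OnePoint ℂ) := by
    rw [affineMoebius_smul_coe, mul_zero, zero_add]
  have hT := hg.mul (transportsPoles_affineMoebius t 0 ht)
  have hdat : IsHurwitzDatum ℓ r n (moebiusHom (g * affineMoebius t 0 ht) f) OnePoint.infty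
      ((0 : ℂ) : OnePoint ℂ) := by
    refine hT.isHurwitzDatum hf0 ?_
    rwa [mul_smul, mul_smul, hi, hz]
  rw [← moebiusHom_mul] at hmonic
  obtain ⟨p, hp, hfp⟩ := exists_eq_superpotentialRat hdat hmonic
  refine ⟨p, hp, g * affineMoebius t 0 ht, ?_, ?_, ?_⟩
  · rw [eval_moebius, hfp]
  · rw [mul_smul, hi]
  · rw [mul_smul, hz]

end HurwitzFrobenius

theorem mainTheorem6 (ℓ r n : ℕ) (hℓ : 1 ≤ ℓ) (hr : 1 ≤ r) (hn : 1 ≤ n) :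
    -- the coordinates `(a, b)`: every class has a representative of the given form
    (∀ p ∈ HurwitzFrobenius.hurwitzDomain ℓ r n,
      HurwitzFrobenius.IsHurwitzDatum ℓ r n (HurwitzFrobenius.superpotentialRat p)
        OnePoint.infty ((0 : ℂ) : OnePoint ℂ)) ∧
    (∀ (f : RatFunc ℂ) (Pinf Pzero : OnePoint ℂ),
      HurwitzFrobenius.IsHurwitzDatum ℓ r n f Pinf Pzero →
      ∃ p ∈ HurwitzFrobenius.hurwitzDomain ℓ r n,
        HurwitzFrobenius.HurwitzEquiv f Pinf Pzero (HurwitzFrobenius.superpotentialRat p)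
          OnePoint.infty ((0 : ℂ) : OnePoint ℂ)) ∧
    ∀ p ∈ HurwitzFrobenius.hurwitzDomain ℓ r n,
      -- the Frobenius product exists and is unique
      (∃! mul, HurwitzFrobenius.IsFrobeniusProduct p mul) ∧
      -- its unity is the stated vector, the only one with `X(λ) = 1`
      (∀ mul, HurwitzFrobenius.IsFrobeniusProduct p mul →
        ∀ X : HurwitzFrobenius.Coord ℓ r n,
          (∀ Y, mul X Y = Y ∧ mul Y X = Y) ↔ X = HurwitzFrobenius.unityField p) ∧
      (∀ X : HurwitzFrobenius.Coord ℓ r n,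
        (∀ w : ℂ, (HurwitzFrobenius.denominator p).eval w ≠ 0 →
          HurwitzFrobenius.lieSuperpotential p X w = 1) ↔
        X = HurwitzFrobenius.unityField p) := by
  refine ⟨fun p hp => HurwitzFrobenius.isHurwitzDatum_superpotentialRat hp,
    fun f Pinf Pzero hf => HurwitzFrobenius.exists_hurwitzEquiv_superpotentialRat hf,
    fun p hp => ⟨HurwitzFrobenius.existsUnique_isFrobeniusProduct hr hp,
      fun mul hmul Y => HurwitzFrobenius.isUnity_iff hr hp hmul Y,
      fun Y => HurwitzFrobenius.lieSuperpotential_eq_one_iff hr hp Y⟩⟩
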